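/- Let $n\ge 0$. Let $B_n$ be the braid group on $n$ strands, with generators $\sigma_1,\dots,\sigma_{n-1}$ and relations $\sigma_i\sigma_{i+1}\sigma_i=\sigma_{i+1}\sigma_i\sigma_{i+1}$ and $\sigma_i\sigma_j=\sigma_j\sigma_i$ for $j>i+1$. Let $SG_n$ be the singular braid group, that is, the group with generators $\sigma_1,\dots,\sigma_{n-1}$ and (if $n\ge 2$) $\tau_1$, the relations of $B_n$, and the relations $$\sigma_2\sigma_1^2\sigma_2\,\tau_1=\tau_1\,\sigma_2\sigma_1^2\sigma_2\ (n\ge 3),\qquad \sigma_i\tau_1=\tau_1\sigma_i\ (i\ne 2),$$ $$\sigma_2\sigma_3\sigma_1\sigma_2\,\tau_1\,\sigma_2\sigma_3\sigma_1\sigma_2\,\tau_1=\tau_1\,\sigma_2\sigma_3\sigma_1\sigma_2\,\tau_1\,\sigma_2\sigma_3\sigma_1\sigma_2\ (n\ge 4).$$ Put $\tau_{i+1}=\sigma_i\sigma_{i+1}\tau_i\sigma_{i+1}^{-1}\sigma_i^{-1}$ for $1\le i\le n-2$. Let the pure braid group $P_n$ be the kernel of the homomorphism from $B_n$ to the symmetric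 group on $\{1,\dots,n\}$ with $\sigma_i\mapsto(i\;\,i{+}1)$, and let the pure singular braid group $SGP_n$ be the kernel of the homomorphism from $SG_n$ to the same group with $\sigma_i\mapsto(i\;\,i{+}1)$ and $\tau_1\mapsto(1\;\,2)$. For $1\le k\le j\le n-1$ put $$a_{k,j}=\sigma_k\sigma_{k+1}\cdots\sigma_{j-1}\,\sigma_j^2\,\sigma_{j-1}^{-1}\cdots\sigma_k^{-1},\qquad X_{k,j}=\sigma_j\sigma_{j-1}\cdots\sigma_{k+1}\,\sigma_k\tau_k\,\sigma_{k+1}^{-1}\cdots\sigma_j^{-1}$$ in $SG_n$; let $X$ be the set of all the $X_{k,j}$ and $A$ the set of all the $a_{k,j}$. For subgroups $L$ and $K$ of a group and an element $x$ of that group, say that $K$ is an HNN extension of $L$ with stable letter $x$ if there is a subgroup $U\le L$ such that $$K=\langle\, L,\ x\mid \mathrm{rel.}\,L,\ x u x^{-1}=u\ (u\in U)\,\rangle,$$ that is, such that the abstract HNN extension of $L$ with both associated subgroups equal to $U$ and with the identity of $U$ as their isomorphism is isomorphic to $K$ by a map that is the inclusion on $L$ and sends the stable letter to $x$. **Theorem.**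 1. For all $1\le i\le j\le n-1$, the group $SGP_n$ is an HNN extension, with stable letter $X_{i,j}$, of its subgroup $H_{i,j}$ generated by $(X\setminus\{X_{i,j}\})\cup A$. 2. Consequently $SGP_n$ is an iterated HNN extension of $P_n$: the natural map $B_n\to SG_n$, $\sigma_i\mapsto\sigma_i$, restricts to an isomorphism from $P_n$ onto the subgroup $G_0$ of $SG_n$ generated by $A$; and for every ordering $Y_1,\dots,Y_N$, where $N=n(n-1)/2$, of the singular generators $X_{i,j}$ there are subgroups $G_0\le G_1\le\dots\le G_N=SGP_n$ such that $G_m$ is an HNN extension of $G_{m-1}$ with stable letter $Y_m$, for each $m=1,\dots,N$. -/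

import Mathlib

namespace SingBraid

/-! ### The braid group and the singular braid group -/

/-- The generators `σ_1, …, σ_{n-1}` of the braid group on `n` strands. -/
inductive BraidGen (n : ℕ) : Type
  | sigma (i : ℕ) (h₁ : 1 ≤ i) (h₂ : i < n) : BraidGen n

/-- The generators `σ_1, …, σ_{n-1}` and `τ_1` of the singular braid group on `n` strands
(there is no `τ_1` on fewer than two strands). -/
inductive SingGen (n : ℕ) : Type
  | sigma (i : ℕ) (h₁ : 1 ≤ i) (h₂ : i < n) : SingGen n
  | tau (h : 2 ≤ n) : SingGen n

/-- The Artin relators in the letters `s 1, …, s (n-1)`. -/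
def artinRels {F : Type*} [Group F] (n : ℕ) (s : ℕ → F) : Set F :=
  {r | (∃ i, 1 ≤ i ∧ i + 1 < n ∧
          r = (s i * s (i + 1) * s i) * (s (i + 1) * s i * s (i + 1))⁻¹) ∨
       (∃ i j, 1 ≤ i ∧ i + 1 < j ∧ j < n ∧ r = (s i * s j) * (s j * s i)⁻¹)}

/-- The relators of the singular braid group that involve the singular letter `t = τ_1`. -/
def singRels {F : Type*} [Group F] (n : ℕ) (s : ℕ → F) (t : F) : Set F :=
  {r | (3 ≤ n ∧
          r = (s 2 * s 1 ^ 2 * s 2 * t) * (t * (s 2 * s 1 ^ 2 * s 2))⁻¹) ∨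
       (∃ i, 1 ≤ i ∧ i < n ∧ i ≠ 2 ∧ r = (s i * t) * (t * s i)⁻¹) ∨
       (4 ≤ n ∧
          r = (s 2 * s 3 * s 1 * s 2 * t * (s 2 * s 3 * s 1 * s 2) * t) *
              (t * (s 2 * s 3 * s 1 * s 2) * t * (s 2 * s 3 * s 1 * s 2))⁻¹)}

/-- The letter `σ_i` in the free group; only used for `1 ≤ i < n`. -/
def braidLetter (n i : ℕ) : FreeGroup (BraidGen n) :=
  if h : 1 ≤ i ∧ i < n then FreeGroup.of (.sigma i h.1 h.2) else 1

/-- The letter `σ_i` in the free group; only used for `1 ≤ i < n`. -/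
def singLetter (n i : ℕ) : FreeGroup (SingGen n) :=
  if h : 1 ≤ i ∧ i < n then FreeGroup.of (.sigma i h.1 h.2) else 1

/-- The letter `τ_1` in the free group; only used for `2 ≤ n`. -/
def tauLetter (n : ℕ) : FreeGroup (SingGen n) :=
  if h : 2 ≤ n then FreeGroup.of (.tau h) else 1

/-- The defining relators of `SG_n`. -/
def sgRels (n : ℕ) : Set (FreeGroup (SingGen n)) :=
  artinRels n (singLetter n) ∪ singRels n (singLetter n) (tauLetter n)

/-- The braid group `B_n`. -/
abbrev B (n : ℕ) : Type := PresentedGroup (artinRels n (braidLetter n))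

/-- The singular braid group `SG_n`. -/
abbrev SG (n : ℕ) : Type := PresentedGroup (sgRels n)

/-- The element `σ_i` of `SG_n`, for `1 ≤ i < n`. -/
def sigma (n i : ℕ) : SG n := PresentedGroup.mk (sgRels n) (singLetter n i)

/-- The elements `τ_i` of `SG_n`, for `1 ≤ i < n`: the generator `τ_1`, and
`τ_{i+1} = σ_i σ_{i+1} τ_i σ_{i+1}⁻¹ σ_i⁻¹`. -/
def tau (n : ℕ) : ℕ → SG n
  | 0 => 1
  | 1 => PresentedGroup.mk (sgRels n) (tauLetter n)
  | i + 2 => sigma n (i + 1) * sigma n (i + 2) * tau n (i + 1) *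
      (sigma n (i + 2))⁻¹ * (sigma n (i + 1))⁻¹

/-! ### The natural maps -/

/-- The transposition `(i, i+1)` of the strands `1, …, n`, which are numbered `0, …, n-1` here;
only used for `1 ≤ i < n`. -/
def adj (n i : ℕ) : Equiv.Perm (Fin n) :=
  if h : 1 ≤ i ∧ i < n then Equiv.swap ⟨i - 1, by omega⟩ ⟨i, h.2⟩ else 1

theorem adj_braid (n i : ℕ) (h₁ : 1 ≤ i) (h₂ : i + 1 < n) :
    adj n i * adj n (i + 1) * adj n i = adj n (i + 1) * adj n i * adj n (i + 1) := by
  have e₁ : 1 ≤ i ∧ i < n := by omega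
  have e₂ : 1 ≤ i + 1 ∧ i + 1 < n := by omega
  simp only [adj, dif_pos e₁, dif_pos e₂, Nat.add_sub_cancel]
  have hab : (⟨i - 1, by omega⟩ : Fin n) ≠ ⟨i, e₁.2⟩ := by rw [Ne, Fin.ext_iff]; show ¬ (i - 1 = i); omega
  have hac : (⟨i - 1, by omega⟩ : Fin n) ≠ ⟨i + 1, e₂.2⟩ := by
    rw [Ne, Fin.ext_iff]; show ¬ (i - 1 = i + 1); omega
  have hbc : (⟨i, e₁.2⟩ : Fin n) ≠ ⟨i + 1, e₂.2⟩ := by simp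
  generalize (⟨i - 1, by omega⟩ : Fin n) = a at *
  generalize (⟨i, e₁.2⟩ : Fin n) = b at *
  generalize (⟨i + 1, e₂.2⟩ : Fin n) = c at *
  rw [Equiv.swap_mul_swap_mul_swap hab hac, Equiv.swap_comm a b, Equiv.swap_comm b c,
    Equiv.swap_mul_swap_mul_swap hbc.symm hac.symm, Equiv.swap_comm]

theorem adj_comm (n i j : ℕ) (h₁ : 1 ≤ i) (h₂ : i + 1 < j) (h₃ : j < n) :
    adj n i * adj n j = adj n j * adj n i := by
  have e₁ : 1 ≤ i ∧ i < n := by omega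
  have e₂ : 1 ≤ j ∧ j < n := by omega
  simp only [adj, dif_pos e₁, dif_pos e₂]
  refine (Equiv.Perm.Disjoint.commute ?_).eq
  rw [Equiv.Perm.disjoint_iff_eq_or_eq]
  intro x
  by_cases hx : x.1 = i - 1 ∨ x.1 = i
  · right
    apply Equiv.swap_apply_of_ne_of_ne <;> simp only [ne_eq, Fin.ext_iff] <;> omega
  · left
    apply Equiv.swap_apply_of_ne_of_ne <;> simp only [ne_eq, Fin.ext_iff] <;> omega

theorem adj_sq (n i : ℕ) : adj n i * adj n i = 1 := by
  unfold adj
  split_ifs <;> simp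

theorem adj_artinRels (n : ℕ) : ∀ r ∈ artinRels n (adj n), r = 1 := by
  rintro r (⟨i, h₁, h₂, rfl⟩ | ⟨i, j, h₁, h₂, h₃, rfl⟩)
  · rw [mul_inv_eq_one]; exact adj_braid n i h₁ h₂
  · rw [mul_inv_eq_one]; exact adj_comm n i j h₁ h₂ h₃

theorem adj_singRels (n : ℕ) : ∀ r ∈ singRels n (adj n) (adj n 1), r = 1 := by
  rintro r (⟨h, rfl⟩ | ⟨i, h₁, h₂, h₃, rfl⟩ | ⟨h, rfl⟩) <;> rw [mul_inv_eq_one]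
  · simp [pow_two, adj_sq]
  · rcases Nat.lt_or_ge 1 i with h | h
    · exact (adj_comm n 1 i le_rfl (by omega) h₂).symm
    · obtain rfl : i = 1 := by omega
      rfl
  · have b₁ := adj_braid n 1 le_rfl (by omega)
    have b₂ := adj_braid n 2 (by omega) (by omega)
    have c := adj_comm n 1 3 le_rfl (by omega) (by omega)
    norm_num at b₁ b₂
    generalize adj n 1 = x at *
    generalize adj n 2 = y at *
    generalize adj n 3 = z at *
    have d₁ : y * z * x * y * x = z * (y * z * x * y) := by
      calc y * z * x * y * x = y * z * (x * y * x) := by group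
        _ = (y * z * y) * (x * y) := by rw [b₁]; group
        _ = z * (y * z * x * y) := by rw [b₂]; group
    have d₂ : y * z * x * y * z = x * (y * z * x * y) := by
      calc y * z * x * y * z = y * (z * x) * y * z := by group
        _ = y * x * (z * y * z) := by rw [← c]; group
        _ = (y * x * y) * (z * y) := by rw [← b₂]; group
        _ = x * (y * (x * z) * y) := by rw [← b₁]; group
        _ = x * (y * z * x * y) := by rw [c]; group
    generalize y * z * x * y = D at *
    calc D * x * D * x = z * D * (z * D) := by rw [mul_assoc (D * x), d₁]
      _ = z * (D * z) * D := by group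
      _ = (z * x) * D * D := by rw [d₂]; group
      _ = x * (z * D) * D := by rw [← c]; group
      _ = x * D * x * D := by rw [← d₁]; group

theorem map_artinRels {F G : Type*} [Group F] [Group G] (f : F →* G) (n : ℕ) (s : ℕ → F)
    {r : F} (hr : r ∈ artinRels n s) : f r ∈ artinRels n (fun i => f (s i)) := by
  rcases hr with ⟨i, h₁, h₂, rfl⟩ | ⟨i, j, h₁, h₂, h₃, rfl⟩
  · exact Or.inl ⟨i, h₁, h₂, by simp⟩
  · exact Or.inr ⟨i, j, h₁, h₂, h₃, by simp⟩

theorem map_singRels {F G : Type*} [Group F] [Group G] (f : F →* G) (n : ℕ) (s : ℕ → F) (t : F)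
    {r : F} (hr : r ∈ singRels n s t) : f r ∈ singRels n (fun i => f (s i)) (f t) := by
  rcases hr with ⟨h, rfl⟩ | ⟨i, h₁, h₂, h₃, rfl⟩ | ⟨h, rfl⟩
  · exact Or.inl ⟨h, by simp⟩
  · exact Or.inr (Or.inl ⟨i, h₁, h₂, h₃, by simp⟩)
  · exact Or.inr (Or.inr ⟨h, by simp⟩)

/-- Where the generators of `B_n` go in the symmetric group. -/
def braidGenPerm (n : ℕ) : BraidGen n → Equiv.Perm (Fin n)
  | .sigma i _ _ => adj n i

/-- Where the generators of `SG_n` go in the symmetric group. -/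
def singGenPerm (n : ℕ) : SingGen n → Equiv.Perm (Fin n)
  | .sigma i _ _ => adj n i
  | .tau _ => adj n 1

/-- Where the generators of `B_n` go in `SG_n`. -/
def braidGenSG (n : ℕ) : BraidGen n → SG n
  | .sigma i _ _ => sigma n i

theorem braidLetter_perm (n i : ℕ) :
    FreeGroup.lift (braidGenPerm n) (braidLetter n i) = adj n i := by
  by_cases h : 1 ≤ i ∧ i < n
  · simp [braidLetter, h, braidGenPerm]
  · rw [braidLetter, adj, dif_neg h, dif_neg h, map_one]

theorem singLetter_perm (n i : ℕ) :
    FreeGroup.lift (singGenPerm n) (singLetter n i) = adj n i := by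
  by_cases h : 1 ≤ i ∧ i < n
  · simp [singLetter, h, singGenPerm]
  · rw [singLetter, adj, dif_neg h, dif_neg h, map_one]

theorem tauLetter_perm (n : ℕ) :
    FreeGroup.lift (singGenPerm n) (tauLetter n) = adj n 1 := by
  by_cases h : 2 ≤ n
  · simp [tauLetter, h, singGenPerm]
  · rw [tauLetter, adj, dif_neg h, dif_neg (by omega), map_one]

theorem braidLetter_SG (n i : ℕ) :
    FreeGroup.lift (braidGenSG n) (braidLetter n i) = sigma n i := by
  by_cases h : 1 ≤ i ∧ i < n
  · simp [braidLetter, h, braidGenSG]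
  · rw [braidLetter, sigma, singLetter, dif_neg h, dif_neg h, map_one, map_one]

theorem braidPerm_aux (n : ℕ) :
    ∀ r ∈ artinRels n (braidLetter n), FreeGroup.lift (braidGenPerm n) r = 1 := by
  intro r hr
  have h := map_artinRels (FreeGroup.lift (braidGenPerm n)) n _ hr
  simp only [braidLetter_perm] at h
  exact adj_artinRels n _ h

theorem singPerm_aux (n : ℕ) :
    ∀ r ∈ sgRels n, FreeGroup.lift (singGenPerm n) r = 1 := by
  rintro r (hr | hr)
  · have h := map_artinRels (FreeGroup.lift (singGenPerm n)) n _ hr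
    simp only [singLetter_perm] at h
    exact adj_artinRels n _ h
  · have h := map_singRels (FreeGroup.lift (singGenPerm n)) n _ _ hr
    simp only [singLetter_perm, tauLetter_perm] at h
    exact adj_singRels n _ h

theorem braidToSG_aux (n : ℕ) :
    ∀ r ∈ artinRels n (braidLetter n), FreeGroup.lift (braidGenSG n) r = 1 := by
  intro r hr
  have h := map_artinRels (FreeGroup.lift (braidGenSG n)) n _ hr
  simp only [braidLetter_SG] at h
  rcases h with ⟨i, h₁, h₂, e⟩ | ⟨i, j, h₁, h₂, h₃, e⟩
  · rw [e]
    simp only [sigma, ← map_mul, ← map_inv]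
    exact PresentedGroup.one_of_mem (Or.inl (Or.inl ⟨i, h₁, h₂, rfl⟩))
  · rw [e]
    simp only [sigma, ← map_mul, ← map_inv]
    exact PresentedGroup.one_of_mem (Or.inl (Or.inr ⟨i, j, h₁, h₂, h₃, rfl⟩))

/-- The natural homomorphism `B_n → Σ_n`, `σ_i ↦ (i, i+1)`. -/
def braidPerm (n : ℕ) : B n →* Equiv.Perm (Fin n) :=
  PresentedGroup.toGroup (braidPerm_aux n)

/-- The natural homomorphism `SG_n → Σ_n`, `σ_i ↦ (i, i+1)`, `τ_1 ↦ (1, 2)`. -/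
def singPerm (n : ℕ) : SG n →* Equiv.Perm (Fin n) :=
  PresentedGroup.toGroup (singPerm_aux n)

/-- The natural homomorphism `B_n → SG_n`, `σ_i ↦ σ_i`. -/
def braidToSG (n : ℕ) : B n →* SG n :=
  PresentedGroup.toGroup (braidToSG_aux n)

/-- The pure braid group `P_n`. -/
def P (n : ℕ) : Subgroup (B n) := (braidPerm n).ker

/-- The pure singular braid group `SGP_n`. -/
def SGP (n : ℕ) : Subgroup (SG n) := (singPerm n).ker

/-! ### The generators of the pure singular braid group -/

/-- The pairs `(i, j)` with `1 ≤ i ≤ j ≤ n - 1`. -/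
abbrev Idx (n : ℕ) : Type := {p : ℕ × ℕ // 1 ≤ p.1 ∧ p.1 ≤ p.2 ∧ p.2 < n}

/-- `σ_k σ_{k+1} ⋯ σ_{j-1}` -/
def ascending (n k j : ℕ) : SG n := ((List.range' k (j - k)).map (sigma n)).prod

/-- `σ_j σ_{j-1} ⋯ σ_{k+1}` -/
def descending (n k j : ℕ) : SG n :=
  ((List.range' (k + 1) (j - k)).reverse.map (sigma n)).prod

/-- `a_{k,j} = σ_k ⋯ σ_{j-1} σ_j² σ_{j-1}⁻¹ ⋯ σ_k⁻¹` -/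
def a {n : ℕ} (p : Idx n) : SG n :=
  ascending n p.1.1 p.1.2 * sigma n p.1.2 ^ 2 * (ascending n p.1.1 p.1.2)⁻¹

/-- `X_{k,j} = σ_j ⋯ σ_{k+1} σ_k τ_k σ_{k+1}⁻¹ ⋯ σ_j⁻¹` -/
def X {n : ℕ} (p : Idx n) : SG n :=
  descending n p.1.1 p.1.2 * sigma n p.1.1 * tau n p.1.1 * (descending n p.1.1 p.1.2)⁻¹

/-- The subgroup generated by all the `a_{k,l}`. -/
def nonsingularSubgroup (n : ℕ) : Subgroup (SG n) :=
  Subgroup.closure (Set.range (a (n := n)))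

/-- The subgroup `H_{i,j}` generated by the singular generators other than `X_{i,j}` and all
the `a_{k,l}`. -/
def H {n : ℕ} (p : Idx n) : Subgroup (SG n) :=
  Subgroup.closure ((Set.range (X (n := n)) \ {X p}) ∪ Set.range (a (n := n)))

/-! ### HNN extensions inside a group -/

/-- The subgroup `K` is the HNN extension of its subgroup `L` with stable letter `x` and the
identity of some subgroup `U` of `L` as associated isomorphism,
`K = ⟨L, x | rel. L, x u x⁻¹ = u (u ∈ U)⟩`, where the isomorphism from the abstract HNN extension
is the inclusion on `L` and sends the stable letter to `x`. -/
def IsHNN {G : Type*} [Group G] (L K : Subgroup G) (x : G) : Prop :=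
  ∃ (U : Subgroup L) (e : HNNExtension L U U (MulEquiv.refl U) ≃* K),
    (∀ h : L, (e (HNNExtension.of h) : G) = h) ∧ (e HNNExtension.t : G) = x

/-- The subgroup `K` arises from the subgroup `L` by successive HNN extensions as in `IsHNN`,
with the entries of the list as stable letters, in that order. -/
inductive IsIteratedHNN {G : Type*} [Group G] : Subgroup G → Subgroup G → List G → Prop
  | nil (L : Subgroup G) : IsIteratedHNN L L []
  | cons (L M K : Subgroup G) (x : G) (l : List G) :
      IsHNN L M x → IsIteratedHNN M K l → IsIteratedHNN L K (x :: l)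

end SingBraid

/-!
The reason behind the theorem is a description of `SG_n` as a semidirect product. Put
`z = σ_1 τ_1`. In terms of `z`, the relations of `SG_n` that involve `τ_1` say that `z` commutes
with the subgroup `C` of `B_n` generated by the `σ_i`, `i ≠ 2`, and by `σ_2 σ_1² σ_2`, and that
`z` commutes with its conjugate by `D = σ_2 σ_3 σ_1 σ_2` (`cross_relation_iff`; this uses that
`D²` is a word in elements that commute with `τ_1`). Hence `SG_n` is the semidirect product of the
graph group on the vertex set `B_n / C`, with edges between `gC` and `gDC`, by `B_n`. Only the
homomorphism `toModel` from `SG_n` to this semidirect product is needed: it shows that `B_n` embeds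
in `SG_n`, and it gives the universal property of the part of `SG_n` lying over the pure braid
group `P_n`, which is `SGP_n` (`isGraphExtension_SGP`).

The orbits of `P_n` on `B_n / C` correspond to the unordered pairs of strands, and the `X_{k,j}`
are the conjugates of `z` at one vertex of each orbit. An edge joins vertices whose pairs of
strands are disjoint, so no edge lies within an orbit. Therefore adjoining to `P_n` and some of
the orbits the generators of one more orbit, with representative `x`, adds exactly one generator
`x`, with the relations that `x` commutes with the stabilizer of its vertex in `P_n` and with the
neighbours of its vertex. This is an HNN extension (`IsGraphExtension.isHNN`), and both the single
decompositions and the iterated ones are instances of it.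

It remains to see that the `a_{k,j}` generate `P_n` (`closure_pureGen_braidSigma`). The subgroup
they generate is normal and contains the `σ_i²`, and the quotient of `B_n` by the `σ_i²` is the
symmetric group, by induction on the number of strands (`IsArtin.eq_one_of_perm_eq_one`).
-/

namespace SingBraid

/-! ### HNN extensions from permuted generators -/

/-- The subgroup generated by the image of `j` and the elements `y p` with `p ∈ J`. -/
def partialSubgroup {S Q ι : Type*} [Group S] [Group Q] (j : Q →* S) (y : ι → S) (J : Set ι) :
    Subgroup S :=
  Subgroup.closure (Set.range j ∪ y '' J)

section PartialSubgroup

variable {S Q ι : Type*} [Group S] [Group Q] {j : Q →* S} {y : ι → S} {J : Set ι}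

theorem map_mem_partialSubgroup (q : Q) : j q ∈ partialSubgroup j y J :=
  Subgroup.subset_closure (Or.inl ⟨q, rfl⟩)

theorem mem_partialSubgroup {p : ι} (hp : p ∈ J) : y p ∈ partialSubgroup j y J :=
  Subgroup.subset_closure (Or.inr ⟨p, hp, rfl⟩)

theorem partialSubgroup_mono {J' : Set ι} (h : J ⊆ J') :
    partialSubgroup j y J ≤ partialSubgroup j y J' :=
  Subgroup.closure_mono (Set.union_subset_union_right _ (Set.image_mono h))

theorem partialSubgroup_le {K : Subgroup S} (hj : ∀ q, j q ∈ K) (hy : ∀ p ∈ J, y p ∈ K) :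
    partialSubgroup j y J ≤ K := by
  rw [partialSubgroup, Subgroup.closure_le]
  rintro _ (⟨q, rfl⟩ | ⟨p, hp, rfl⟩)
  · exact hj q
  · exact hy p hp

end PartialSubgroup

/-- `j : Q →* S` and the family `x : V → S`, on which `Q` acts by conjugation, present the
subgroup `K` of `S`: besides the relations of `Q` and the relations `q x_v q⁻¹ = x_{qv}`, the only
relations are that `x_v` and `x_w` commute when `E v w`. This is expressed by the universal
property, with test groups in the universe of `S`, which is that of the HNN extensions of its
subgroups. -/
structure IsGraphExtension {S Q V : Type} [Group S] [Group Q] [MulAction Q V] (j : Q →* S)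
    (x : V → S) (E : V → V → Prop) (K : Subgroup S) : Prop where
  map_mem : ∀ q, j q ∈ K
  mem : ∀ v, x v ∈ K
  conj : ∀ q v, x (q • v) = j q * x v * (j q)⁻¹
  commute : ∀ v w, E v w → Commute (x v) (x w)
  smul : ∀ (q : Q) v w, E v w → E (q • v) (q • w)
  lift : ∀ {M : Type} [Group M] (f : Q →* M) (g : V → M),
    (∀ q v, g (q • v) = f q * g v * (f q)⁻¹) → (∀ v w, E v w → Commute (g v) (g w)) →
    ∃ Φ : K →* M, (∀ q h, Φ ⟨j q, h⟩ = f q) ∧ ∀ v h, Φ ⟨x v, h⟩ = g v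

/-- Adjoining one orbit of generators to a union of orbits is an HNN extension. The associated
subgroup `U` is generated by the stabilizer of the vertex `v i` and by its neighbours; the
inverse of the canonical map from the abstract HNN extension comes from the universal property,
the generators of the orbits that are not involved being sent to `1`. -/
theorem IsGraphExtension.isHNN {S Q V ι : Type} [Group S] [Group Q] [MulAction Q V] {j : Q →* S}
    {x : V → S} {E : V → V → Prop} {K : Subgroup S} (hK : IsGraphExtension j x E K)
    (v : ι → V) (hsurj : ∀ w, ∃ p, ∃ q : Q, q • v p = w)
    (hinj : ∀ p p' (q : Q), q • v p = v p' → p = p')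
    (hE : ∀ p (q q' : Q), ¬ E (q • v p) (q' • v p)) (hsymm : ∀ v w, E v w → E w v)
    (J : Set ι) (i : ι) (hi : i ∉ J) :
    IsHNN (partialSubgroup j (fun p => x (v p)) J)
      (partialSubgroup j (fun p => x (v p)) (insert i J)) (x (v i)) := by
  classical
  -- `rep w` names the orbit of `w`, and `tr w` takes its representative to `w`
  choose rep tr htr using hsurj
  set L := partialSubgroup j (fun p => x (v p)) J with hL
  have rep_smul : ∀ (q : Q) w, rep (q • w) = rep w := by
    intro q w
    refine hinj _ _ ((tr w)⁻¹ * q⁻¹ * tr (q • w)) ?_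
    rw [mul_smul, mul_smul, htr, inv_smul_smul, inv_smul_eq_iff, htr]
  have rep_v : ∀ p, rep (v p) = p := fun p => hinj _ _ (tr (v p)) (htr _)
  have hxL : ∀ w, rep w ∈ J → x w ∈ L := by
    intro w hw
    rw [← htr w, hK.conj]
    exact L.mul_mem (L.mul_mem (map_mem_partialSubgroup _)
      (mem_partialSubgroup (y := fun p => x (v p)) hw)) (L.inv_mem (map_mem_partialSubgroup _))
  have hjL : ∀ q, j q ∈ L := fun q => map_mem_partialSubgroup _
  have hLK : L ≤ K := partialSubgroup_le hK.map_mem fun p _ => hK.mem _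
  have hLK' : L ≤ partialSubgroup j (fun p => x (v p)) (insert i J) :=
    partialSubgroup_mono (Set.subset_insert _ _)
  let T : Set L := {u | (∃ q : Q, q • v i = v i ∧ (u : S) = j q) ∨
    ∃ w, E w (v i) ∧ (u : S) = x w}
  let U : Subgroup L := Subgroup.closure T
  have hU : ∀ u : U, x (v i) * L.subtype u = L.subtype (MulEquiv.refl U u : L) * x (v i) := by
    rintro ⟨u, hu⟩
    have : U ≤ (Subgroup.centralizer {x (v i)}).comap L.subtype := by
      rw [Subgroup.closure_le]
      intro u hu
      simp only [Subgroup.coe_comap, Set.mem_preimage, SetLike.mem_coe,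
        Subgroup.mem_centralizer_singleton_iff, Subgroup.coe_subtype]
      rcases hu with ⟨q, hq, h⟩ | ⟨w, hw, h⟩
      · rw [h]
        conv_rhs => rw [← hq, hK.conj]
        group
      · rw [h]
        exact (hK.commute _ _ hw)
    exact (Subgroup.mem_centralizer_singleton_iff.1 (this hu)).symm
  let toK : HNNExtension L U U (MulEquiv.refl U) →* S := HNNExtension.lift L.subtype (x (v i)) hU
  have toK_of : ∀ l : L, toK (HNNExtension.of l) = l := fun l => HNNExtension.lift_of _ _ _ _
  have toK_t : toK HNNExtension.t = x (v i) := HNNExtension.lift_t _ _ _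
  let f : Q →* HNNExtension L U U (MulEquiv.refl U) := HNNExtension.of.comp (j.codRestrict L hjL)
  have hUt : ∀ u ∈ U, Commute (HNNExtension.of u : HNNExtension L U U (MulEquiv.refl U))
      HNNExtension.t := fun u hu =>
    (HNNExtension.t_mul_of (φ := MulEquiv.refl U) ⟨u, hu⟩).symm
  have hstab : ∀ q : Q, q • v i = v i → Commute (f q) HNNExtension.t := fun q hq =>
    hUt _ (Subgroup.subset_closure (Or.inl ⟨q, hq, rfl⟩))
  have hstab' : ∀ q q' : Q, q • v i = q' • v i →
      f q * HNNExtension.t * (f q)⁻¹ = f q' * HNNExtension.t * (f q')⁻¹ := by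
    intro q q' h
    have := (hstab (q'⁻¹ * q) (by rw [mul_smul, h, inv_smul_smul])).eq
    rw [map_mul, map_inv] at this
    calc f q * HNNExtension.t * (f q)⁻¹
        = f q' * ((f q')⁻¹ * f q * HNNExtension.t) * (f q)⁻¹ := by group
      _ = _ := by rw [this]; group
  -- the images of the generators in the abstract HNN extension
  let g : V → HNNExtension L U U (MulEquiv.refl U) := fun w =>
    if h : rep w ∈ J then HNNExtension.of ⟨x w, hxL w h⟩
    else if rep w = i then f (tr w) * HNNExtension.t * (f (tr w))⁻¹ else 1
  have gJ : ∀ w (h : rep w ∈ J), g w = HNNExtension.of ⟨x w, hxL w h⟩ := fun w h => dif_pos h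
  have gi : ∀ q : Q, g (q • v i) = f q * HNNExtension.t * (f q)⁻¹ := by
    intro q
    have h : rep (q • v i) = i := by rw [rep_smul, rep_v]
    have h' : rep (q • v i) ∉ J := by rw [h]; exact hi
    simp only [g]
    rw [dif_neg h', if_pos h]
    apply hstab'
    have := htr (q • v i)
    rwa [h] at this
  have g0 : ∀ w, rep w ∉ J → rep w ≠ i → g w = 1 := fun w h h' => by
    simp only [g]
    rw [dif_neg h, if_neg h']
  have gcomm : ∀ w (q : Q), rep w ∈ J → E w (q • v i) → Commute (g w) (g (q • v i)) := by
    intro w q hw h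
    have h1 : rep (q⁻¹ • w) ∈ J := by rwa [rep_smul]
    have h2 : E (q⁻¹ • w) (v i) := by simpa using hK.smul q⁻¹ _ _ h
    have h3 := hUt ⟨x (q⁻¹ • w), hxL _ h1⟩ (Subgroup.subset_closure (Or.inr ⟨_, h2, rfl⟩))
    have h4 : g w = f q * HNNExtension.of ⟨x (q⁻¹ • w), hxL _ h1⟩ * (f q)⁻¹ := by
      rw [gJ w hw]
      simp only [f, MonoidHom.comp_apply, ← map_mul, ← map_inv]
      congr 1
      ext
      simp [hK.conj, mul_assoc]
    rw [h4, gi]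
    show _ = _
    have := h3.eq
    calc _ = f q * (HNNExtension.of ⟨x (q⁻¹ • w), hxL _ h1⟩ * HNNExtension.t) * (f q)⁻¹ := by group
      _ = _ := by rw [this]; group
  have hcases : ∀ w, rep w = i → ∃ q : Q, w = q • v i := fun w h => ⟨tr w, by
    have := htr w; rw [h] at this; exact this.symm⟩
  obtain ⟨Φ, Φj, Φx⟩ := hK.lift f g (by
    intro q w
    by_cases h : rep w ∈ J
    · rw [gJ w h, gJ (q • w) (by rwa [rep_smul])]
      simp only [f, MonoidHom.comp_apply, ← map_mul, ← map_inv]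
      congr 1
      ext
      simp [hK.conj]
    · by_cases h' : rep w = i
      · obtain ⟨q', rfl⟩ := hcases w h'
        rw [← mul_smul, gi, gi, map_mul]
        group
      · rw [g0 w h h', g0 _ (by rwa [rep_smul]) (by rwa [rep_smul])]
        group) (by
    intro w w' hw
    by_cases h1 : rep w ∈ J
    · by_cases h2 : rep w' ∈ J
      · rw [gJ w h1, gJ w' h2]
        refine Commute.map ?_ _
        ext
        exact hK.commute _ _ hw
      · by_cases h3 : rep w' = i
        · obtain ⟨q', rfl⟩ := hcases w' h3
          exact gcomm w q' h1 hw
        · rw [g0 w' h2 h3]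
          exact Commute.one_right _
    · by_cases h4 : rep w = i
      · obtain ⟨q, rfl⟩ := hcases w h4
        by_cases h2 : rep w' ∈ J
        · exact (gcomm w' q h2 (hsymm _ _ hw)).symm
        · by_cases h3 : rep w' = i
          · obtain ⟨q', rfl⟩ := hcases w' h3
            exact absurd hw (hE _ _ _)
          · rw [g0 w' h2 h3]
            exact Commute.one_right _
      · rw [g0 w h1 h4]
        exact Commute.one_left _)
  have toK_mem : ∀ z, toK z ∈ partialSubgroup j (fun p => x (v p)) (insert i J) := by
    intro z
    induction z using HNNExtension.induction_on with
    | of l => rw [toK_of]; exact hLK' l.2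
    | t =>
      rw [toK_t]
      exact mem_partialSubgroup (y := fun p => x (v p)) (Set.mem_insert _ _)
    | mul a b ha hb => rw [map_mul]; exact Subgroup.mul_mem _ ha hb
    | inv a ha => rw [map_inv]; exact Subgroup.inv_mem _ ha
  have hK' : partialSubgroup j (fun p => x (v p)) (insert i J) ≤ K :=
    partialSubgroup_le hK.map_mem fun p _ => hK.mem _
  have hcomp : (Φ.comp (toK.codRestrict K fun z => hK' (toK_mem z))) = MonoidHom.id _ := by
    refine HNNExtension.hom_ext ?_ ?_
    · -- two homomorphisms on `L` that agree on its generators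
      ext ⟨l, hl⟩
      have key : ∀ l (hl : l ∈ L), Φ ⟨l, hLK hl⟩ = HNNExtension.of ⟨l, hl⟩ := by
        intro l hl
        induction hl using Subgroup.closure_induction with
        | mem l h =>
          rcases h with ⟨q, rfl⟩ | ⟨p, hp, rfl⟩
          · exact Φj q _
          · have h1 : rep (v p) ∈ J := by rwa [rep_v]
            exact (Φx (v p) _).trans (gJ _ h1)
        | one => exact (map_one Φ).trans (map_one HNNExtension.of).symm
        | mul a b ha hb iha ihb =>
          have := congrArg₂ (· * ·) iha ihb
          simp only [← map_mul] at this
          exact this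
        | inv a ha iha =>
          have := congrArg (·⁻¹) iha
          simp only [← map_inv] at this
          exact this
      exact (congrArg Φ (Subtype.ext (toK_of ⟨l, hl⟩))).trans (key l hl)
    · exact (congrArg Φ (Subtype.ext toK_t)).trans
        ((Φx (v i) (hK.mem _)).trans (by simpa using gi 1))
  have hinjK : Function.Injective toK := by
    intro a b hab
    have h1 := DFunLike.congr_fun hcomp a
    have h2 := DFunLike.congr_fun hcomp b
    rw [MonoidHom.id_apply] at h1 h2
    rw [← h1, ← h2]
    simp only [MonoidHom.comp_apply]
    congr 1
    ext
    exact hab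
  have hrange : toK.range = partialSubgroup j (fun p => x (v p)) (insert i J) := by
    apply le_antisymm
    · rintro _ ⟨z, rfl⟩
      exact toK_mem z
    · refine partialSubgroup_le (fun q => ⟨_, toK_of ⟨j q, hjL q⟩⟩) ?_
      rintro p (rfl | hp)
      · exact ⟨_, toK_t⟩
      · exact ⟨_, toK_of ⟨x (v p), mem_partialSubgroup (y := fun p => x (v p)) hp⟩⟩
  exact ⟨U, (MonoidHom.ofInjective hinjK).trans (MulEquiv.subgroupCongr hrange), toK_of, toK_t⟩

/-! ### Graph groups and their semidirect products -/

/-- The graph group (right-angled Artin group) of the relation `E`: generated by `V`, with `v` and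
`w` commuting when `E v w`. -/
abbrev GraphGroup {V : Type} (E : V → V → Prop) : Type :=
  PresentedGroup {r : FreeGroup V | ∃ v w, E v w ∧
    r = FreeGroup.of v * FreeGroup.of w * (FreeGroup.of w * FreeGroup.of v)⁻¹}

namespace GraphGroup

variable {V : Type} {E : V → V → Prop}

/-- The generator of the graph group at a vertex. -/
def gen (E : V → V → Prop) (v : V) : GraphGroup E := PresentedGroup.of v

theorem commute_gen {v w : V} (h : E v w) : Commute (gen E v) (gen E w) :=
  PresentedGroup.mk_eq_mk_of_mul_inv_mem ⟨v, w, h, rfl⟩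

/-- The homomorphism from the graph group given by the images of the vertices. -/
def lift {M : Type*} [Group M] (g : V → M) (hg : ∀ v w, E v w → Commute (g v) (g w)) :
    GraphGroup E →* M :=
  PresentedGroup.toGroup (f := g) (by
    rintro _ ⟨v, w, h, rfl⟩
    simpa only [map_mul, map_inv, FreeGroup.lift_apply_of, mul_inv_eq_one] using (hg v w h).eq)

@[simp]
theorem lift_gen {M : Type*} [Group M] (g : V → M) (hg : ∀ v w, E v w → Commute (g v) (g w))
    (v : V) : lift g hg (gen E v) = g v :=
  PresentedGroup.toGroup.of _

theorem hom_ext {M : Type*} [Group M] {f g : GraphGroup E →* M}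
    (h : ∀ v, f (gen E v) = g (gen E v)) : f = g :=
  PresentedGroup.ext h

/-- Distinct vertices are distinct generators, since they stay distinct in the free abelian group
on the vertices. -/
theorem gen_injective : Function.Injective (gen E) := by
  intro v w h
  have := congrArg (lift (fun v => Multiplicative.ofAdd (Finsupp.single v (1 : ℤ)))
    fun _ _ _ => Commute.all _ _) h
  simpa [Finsupp.single_left_inj] using this

variable {G : Type} [Group G] [MulAction G V]

/-- The action on the graph group induced by an action on the graph. -/
def action (hE : ∀ (b : G) v w, E v w → E (b • v) (b • w)) : G →* MulAut (GraphGroup E) where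
  toFun b := MonoidHom.toMulEquiv
    (lift (fun v => gen E (b • v)) fun v w h => commute_gen (hE b v w h))
    (lift (fun v => gen E (b⁻¹ • v)) fun v w h => commute_gen (hE b⁻¹ v w h))
    (hom_ext fun v => by simp) (hom_ext fun v => by simp)
  map_one' := MulEquiv.toMonoidHom_injective (hom_ext fun v => by
    simp)
  map_mul' b c := MulEquiv.toMonoidHom_injective (hom_ext fun v => by
    simp [mul_smul])

@[simp]
theorem action_gen (hE : ∀ (b : G) v w, E v w → E (b • v) (b • w)) (b : G) (v : V) :
    action hE b (gen E v) = gen E (b • v) :=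
  lift_gen (fun v => gen E (b • v)) (fun v w h => commute_gen (hE b v w h)) v

end GraphGroup

/-- A homomorphism from `S` to the semidirect product of the graph group by `G` that inverts the
obvious assignments on generators yields the universal property for the part of `S` lying over a
subgroup `Q` of `G`. -/
theorem isGraphExtension_of_hom {S G V : Type} [Group S] [Group G] [MulAction G V] (j : G →* S)
    (x : V → S) (E : V → V → Prop) (hE : ∀ (b : G) v w, E v w → E (b • v) (b • w))
    (conj : ∀ q v, x (q • v) = j q * x v * (j q)⁻¹)
    (commute : ∀ v w, E v w → Commute (x v) (x w))
    (Ψ : S →* GraphGroup E ⋊[GraphGroup.action hE] G)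
    (hΨj : ∀ b, Ψ (j b) = SemidirectProduct.inr b)
    (hΨx : ∀ v, Ψ (x v) = SemidirectProduct.inl (GraphGroup.gen E v))
    (Q : Subgroup G) (K : Subgroup S) (hK : ∀ s ∈ K, (Ψ s).right ∈ Q)
    (hj : ∀ q ∈ Q, j q ∈ K) (hx : ∀ v, x v ∈ K) :
    IsGraphExtension (j.comp Q.subtype) x E K where
  map_mem q := hj q q.2
  mem := hx
  conj q v := conj q v
  commute := commute
  smul q v w h := hE q v w h
  lift {M} _ f g hg hcomm := by
    have key : ∀ (q : Q) (r : GraphGroup E), GraphGroup.lift g hcomm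
        (GraphGroup.action hE q r) = f q * GraphGroup.lift g hcomm r * (f q)⁻¹ := by
      intro q r
      have : (GraphGroup.lift g hcomm).comp (GraphGroup.action hE (q : G)).toMonoidHom =
          (MulAut.conj (f q)).toMonoidHom.comp (GraphGroup.lift g hcomm) := by
        refine GraphGroup.hom_ext fun v => ?_
        simp only [MonoidHom.comp_apply, MulEquiv.toMonoidHom_eq_coe, MonoidHom.coe_coe,
          GraphGroup.action_gen, GraphGroup.lift_gen, MulAut.conj_apply]
        exact hg q v
      simpa using DFunLike.congr_fun this r
    refine ⟨MonoidHom.mk' (fun s => GraphGroup.lift g hcomm (Ψ s).left *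
      f ⟨(Ψ s).right, hK s s.2⟩) ?_, ?_, ?_⟩
    · intro s s'
      have h1 : (⟨(Ψ ↑(s * s')).right, hK _ (s * s').2⟩ : Q) =
          ⟨(Ψ s).right, hK s s.2⟩ * ⟨(Ψ s').right, hK s' s'.2⟩ := by
        ext; simp
      rw [h1, map_mul f, Subgroup.coe_mul, map_mul Ψ, SemidirectProduct.mul_left, map_mul,
        key ⟨(Ψ s).right, hK s s.2⟩]
      group
    · intro q h
      have h1 : ∀ h', (⟨(Ψ (j q)).right, h'⟩ : Q) = q := fun h' => by ext; simp [hΨj]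
      simp [hΨj]
    · intro v h
      simp only [MonoidHom.mk'_apply, hΨx, SemidirectProduct.left_inl, GraphGroup.lift_gen,
        SemidirectProduct.right_inl]
      exact (congrArg _ (map_one f)).trans (mul_one _)

/-! ### Families satisfying the Artin relations -/

/-- The elements `s 1, …, s (n-1)` satisfy the Artin relations. -/
structure IsArtin {G : Type*} [Group G] (n : ℕ) (s : ℕ → G) : Prop where
  braid : ∀ i, 1 ≤ i → i + 1 < n → s i * s (i + 1) * s i = s (i + 1) * s i * s (i + 1)
  comm : ∀ i j, 1 ≤ i → i + 1 < j → j < n → s i * s j = s j * s i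

/-- The product `s k * s (k+1) * ⋯ * s (j-1)`. -/
def asc {G : Type*} [Group G] (s : ℕ → G) (k j : ℕ) : G :=
  ((List.range' k (j - k)).map s).prod

/-- The product `s j * s (j-1) * ⋯ * s (k+1)`. -/
def desc {G : Type*} [Group G] (s : ℕ → G) (k j : ℕ) : G :=
  ((List.range' (k + 1) (j - k)).reverse.map s).prod

/-- The element `s k ⋯ s (j-1) * s j ^ 2 * (s k ⋯ s (j-1))⁻¹`. -/
def pureGen {G : Type*} [Group G] (s : ℕ → G) (k j : ℕ) : G :=
  asc s k j * s j ^ 2 * (asc s k j)⁻¹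

section Words

variable {G : Type*} [Group G] (s : ℕ → G)

@[simp]
theorem asc_self (k : ℕ) : asc s k k = 1 := by simp [asc]

@[simp]
theorem desc_self (k : ℕ) : desc s k k = 1 := by simp [desc]

theorem asc_mul_asc {k m j : ℕ} (h : k ≤ m) (h' : m ≤ j) :
    asc s k m * asc s m j = asc s k j := by
  obtain ⟨a, rfl⟩ := Nat.exists_eq_add_of_le h
  obtain ⟨b, rfl⟩ := Nat.exists_eq_add_of_le h'
  rw [asc, asc, asc, ← List.prod_append, ← List.map_append]
  congr 2
  have : k + a + b - k = a + b := by omega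
  rw [this, ← List.range'_append]
  simp

theorem desc_mul_desc {k m j : ℕ} (h : k ≤ m) (h' : m ≤ j) :
    desc s m j * desc s k m = desc s k j := by
  obtain ⟨a, rfl⟩ := Nat.exists_eq_add_of_le h
  obtain ⟨b, rfl⟩ := Nat.exists_eq_add_of_le h'
  rw [desc, desc, desc, ← List.prod_append, ← List.map_append, ← List.reverse_append]
  congr 3
  have : k + a + b - k = a + b := by omega
  rw [this, ← List.range'_append]
  simp [add_right_comm]

@[simp]
theorem asc_succ_self (k : ℕ) : asc s k (k + 1) = s k := by simp [asc]

@[simp]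
theorem desc_succ_self (k : ℕ) : desc s k (k + 1) = s (k + 1) := by simp [desc]

theorem asc_succ {k j : ℕ} (h : k ≤ j) : asc s k (j + 1) = asc s k j * s j := by
  rw [← asc_mul_asc s h j.le_succ, asc_succ_self]

theorem asc_eq_mul {k j : ℕ} (h : k < j) : asc s k j = s k * asc s (k + 1) j := by
  rw [← asc_mul_asc s k.le_succ h, asc_succ_self]

theorem desc_succ {k j : ℕ} (h : k ≤ j) : desc s k (j + 1) = s (j + 1) * desc s k j := by
  rw [← desc_mul_desc s h j.le_succ, desc_succ_self]

theorem desc_eq_mul {k j : ℕ} (h : k < j) : desc s k j = desc s (k + 1) j * s (k + 1) := by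
  rw [← desc_mul_desc s k.le_succ h, desc_succ_self]

theorem map_asc {G' : Type*} [Group G'] (f : G →* G') (k j : ℕ) :
    f (asc s k j) = asc (fun i => f (s i)) k j := by
  simp [asc, map_list_prod, Function.comp_def]

theorem map_desc {G' : Type*} [Group G'] (f : G →* G') (k j : ℕ) :
    f (desc s k j) = desc (fun i => f (s i)) k j := by
  simp [desc, map_list_prod, Function.comp_def]

theorem map_pureGen {G' : Type*} [Group G'] (f : G →* G') (k j : ℕ) :
    f (pureGen s k j) = pureGen (fun i => f (s i)) k j := by
  simp [pureGen, map_asc]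

variable {s}

theorem asc_mem {L : Subgroup G} {k j : ℕ} (h : ∀ i, k ≤ i → i < j → s i ∈ L) :
    asc s k j ∈ L := by
  refine Subgroup.list_prod_mem _ fun y hy => ?_
  obtain ⟨i, hi, rfl⟩ := List.mem_map.1 hy
  rw [List.mem_range'_1] at hi
  exact h i hi.1 (by omega)

theorem desc_mem {L : Subgroup G} {k j : ℕ} (h : ∀ i, k < i → i ≤ j → s i ∈ L) :
    desc s k j ∈ L := by
  refine Subgroup.list_prod_mem _ fun y hy => ?_
  obtain ⟨i, hi, rfl⟩ := List.mem_map.1 hy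
  rw [List.mem_reverse, List.mem_range'_1] at hi
  exact h i (by omega) (by omega)

theorem commute_asc {y : G} {k j : ℕ} (h : ∀ i, k ≤ i → i < j → Commute y (s i)) :
    Commute y (asc s k j) := by
  refine (Subgroup.mem_centralizer_singleton_iff.1
    (asc_mem (L := Subgroup.centralizer {y}) ?_)).symm
  intro i h1 h2
  exact Subgroup.mem_centralizer_singleton_iff.2 (h i h1 h2).symm

theorem commute_desc {y : G} {k j : ℕ} (h : ∀ i, k < i → i ≤ j → Commute y (s i)) :
    Commute y (desc s k j) := by
  refine (Subgroup.mem_centralizer_singleton_iff.1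
    (desc_mem (L := Subgroup.centralizer {y}) ?_)).symm
  intro i h1 h2
  exact Subgroup.mem_centralizer_singleton_iff.2 (h i h1 h2).symm

end Words

namespace IsArtin

variable {G : Type*} [Group G] {n : ℕ} {s : ℕ → G}

theorem commute (hs : IsArtin n s) {i j : ℕ} (hi : 1 ≤ i) (hi' : i < n) (hj : 1 ≤ j) (hj' : j < n)
    (h : i + 1 < j ∨ j + 1 < i ∨ i = j) : Commute (s i) (s j) := by
  rcases h with h | h | rfl
  · exact hs.comm i j hi h hj'
  · exact (hs.comm j i hj h hi').symm
  · exact Commute.refl _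

/-- A letter strictly inside an ascending word passes through it with its index lowered by one. -/
theorem mul_asc (hs : IsArtin n s) {k i j : ℕ} (hk : 1 ≤ k) (hki : k ≤ i) (hij : i + 1 < j)
    (hj : j ≤ n) : s (i + 1) * asc s k j = asc s k j * s i := by
  have h1 : Commute (s (i + 1)) (asc s k i) := commute_asc fun l h h' =>
    hs.commute (by omega) (by omega) (by omega) (by omega) (by omega)
  have h2 : Commute (s i) (asc s (i + 2) j) := commute_asc fun l h h' =>
    hs.commute (by omega) (by omega) (by omega) (by omega) (by omega)
  rw [← asc_mul_asc s hki (show i ≤ j by omega), asc_eq_mul s (show i < j by omega),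
    asc_eq_mul s hij]
  calc s (i + 1) * (asc s k i * (s i * (s (i + 1) * asc s (i + 2) j)))
      = (s (i + 1) * asc s k i) * (s i * s (i + 1) * asc s (i + 2) j) := by group
    _ = asc s k i * (s (i + 1) * s i * s (i + 1)) * asc s (i + 2) j := by rw [h1.eq]; group
    _ = asc s k i * s i * s (i + 1) * (s i * asc s (i + 2) j) := by
        rw [← hs.braid i (by omega) (by omega)]; group
    _ = _ := by rw [h2.eq]; group

/-- A letter strictly inside a descending word passes through it with its index lowered by one. -/
theorem desc_mul (hs : IsArtin n s) {k i j : ℕ} (hki : k < i) (hij : i + 1 ≤ j)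
    (hj : j < n) : desc s k j * s (i + 1) = s i * desc s k j := by
  obtain ⟨i, rfl⟩ : ∃ l, i = l + 1 := ⟨i - 1, by omega⟩
  have h1 : Commute (s (i + 2)) (desc s k i) := commute_desc fun l h h' =>
    hs.commute (by omega) (by omega) (by omega) (by omega) (by omega)
  have h2 : Commute (s (i + 1)) (desc s (i + 2) j) := commute_desc fun l h h' =>
    hs.commute (by omega) (by omega) (by omega) (by omega) (by omega)
  rw [← desc_mul_desc s (show k ≤ i by omega) (show i ≤ j by omega),
    desc_eq_mul s (show i < j by omega), desc_eq_mul s (show i + 1 < j by omega)]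
  calc desc s (i + 2) j * s (i + 2) * s (i + 1) * desc s k i * s (i + 2)
      = desc s (i + 2) j * s (i + 2) * s (i + 1) * (s (i + 2) * desc s k i) := by
        rw [h1.eq]; group
    _ = desc s (i + 2) j * (s (i + 2) * s (i + 1) * s (i + 2)) * desc s k i := by group
    _ = (desc s (i + 2) j * s (i + 1)) * s (i + 2) * s (i + 1) * desc s k i := by
        rw [← hs.braid (i + 1) (by omega) (by omega)]; group
    _ = _ := by rw [← h2.eq]; group

theorem conj_pureGen_left (k j : ℕ) (h : k < j) :
    s k * pureGen s (k + 1) j * (s k)⁻¹ = pureGen s k j := by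
  rw [pureGen, pureGen, asc_eq_mul s h]
  group

theorem conj_pureGen_right (hs : IsArtin n s) {k j : ℕ} (hk : 1 ≤ k) (h : k ≤ j) (hj : j + 1 < n) :
    s (j + 1) * pureGen s k (j + 1) * (s (j + 1))⁻¹ = pureGen s k j := by
  have h1 : Commute (s (j + 1)) (asc s k j) := commute_asc fun l h h' =>
    hs.commute (by omega) (by omega) (by omega) (by omega) (by omega)
  have h2 : s (j + 1) * s j * s (j + 1) ^ 2 = s j ^ 2 * s (j + 1) * s j := by
    have := hs.braid j (by omega) hj
    calc s (j + 1) * s j * s (j + 1) ^ 2 = (s (j + 1) * s j * s (j + 1)) * s (j + 1) := by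
          simp only [pow_two, mul_assoc]
      _ = s j * (s (j + 1) * s j * s (j + 1)) := by rw [← this]; simp only [mul_assoc, ← this]
      _ = _ := by rw [← this]; simp only [pow_two, mul_assoc]
  have h3 : s (j + 1) * asc s k j * s j * s (j + 1) ^ 2 =
      asc s k j * s j ^ 2 * s (j + 1) * s j := by
    rw [h1.eq]
    calc asc s k j * s (j + 1) * s j * s (j + 1) ^ 2
        = asc s k j * (s (j + 1) * s j * s (j + 1) ^ 2) := by group
      _ = _ := by rw [h2]; group
  rw [pureGen, pureGen, asc_succ s h]
  calc s (j + 1) * (asc s k j * s j * s (j + 1) ^ 2 * (asc s k j * s j)⁻¹) * (s (j + 1))⁻¹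
      = (s (j + 1) * asc s k j * s j * s (j + 1) ^ 2) * (s j)⁻¹ * (s (j + 1) * asc s k j)⁻¹ := by
        group
    _ = _ := by rw [h3, h1.eq]; group

theorem commute_pureGen (hs : IsArtin n s) {i k j : ℕ} (hi : 1 ≤ i) (hi' : i < n) (hk : 1 ≤ k)
    (hkj : k ≤ j) (hj : j < n)
    (h : i + 1 < k ∨ j + 1 < i ∨ (k < i ∧ i < j) ∨ (i = k ∧ i = j)) :
    Commute (s i) (pureGen s k j) := by
  have aux : i + 1 < k ∨ j + 1 < i → Commute (s i) (pureGen s k j) := by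
    intro h
    have h1 : Commute (s i) (asc s k j) := commute_asc fun l h h' =>
      hs.commute (by omega) (by omega) (by omega) (by omega) (by omega)
    exact (h1.mul_right ((hs.commute hi hi' (by omega) hj (by omega)).pow_right 2)).mul_right
      h1.inv_right
  rcases h with h | h | ⟨h, h'⟩ | ⟨rfl, rfl⟩
  · exact aux (Or.inl h)
  · exact aux (Or.inr h)
  · obtain ⟨i, rfl⟩ : ∃ l, i = l + 1 := ⟨i - 1, by omega⟩
    have h1 := hs.mul_asc hk (show k ≤ i by omega) h' hj.le
    have h2 : Commute (s i) (s j ^ 2) :=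
      (hs.commute (by omega) (by omega) (by omega) hj (by omega)).pow_right 2
    have h3 : s (i + 1) = asc s k j * s i * (asc s k j)⁻¹ := eq_mul_inv_of_mul_eq h1
    rw [h3, pureGen]
    exact h2.conj _
  · simp [pureGen]

/-- The elements `pureGen s k j` generate a normal subgroup: conjugation by `s i` or by its inverse
turns each of them into another one, or into itself. -/
theorem normal_closure_pureGen (hs : IsArtin n s)
    (htop : Subgroup.closure {g | ∃ i, 1 ≤ i ∧ i < n ∧ g = s i} = ⊤) :
    (Subgroup.closure {g | ∃ k j, 1 ≤ k ∧ k ≤ j ∧ j < n ∧ g = pureGen s k j}).Normal := by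
  set L := Subgroup.closure {g | ∃ k j, 1 ≤ k ∧ k ≤ j ∧ j < n ∧ g = pureGen s k j} with hL
  have hmem : ∀ k j, 1 ≤ k → k ≤ j → j < n → pureGen s k j ∈ L := fun k j h1 h2 h3 =>
    Subgroup.subset_closure ⟨k, j, h1, h2, h3, rfl⟩
  have hsq : ∀ i, 1 ≤ i → i < n → s i ^ 2 ∈ L := fun i h1 h2 => by
    have := hmem i i h1 le_rfl h2
    rwa [pureGen, asc_self, one_mul, inv_one, mul_one] at this
  -- As `s i ^ 2` lies in `L`, conjugation by `s i` and by its inverse agree up to `L`.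
  have hone : ∀ i, 1 ≤ i → i < n → ∀ g, s i * g * (s i)⁻¹ ∈ L ∨ (s i)⁻¹ * g * s i ∈ L →
      s i * g * (s i)⁻¹ ∈ L ∧ (s i)⁻¹ * g * s i ∈ L := by
    rintro i h1 h2 g (h | h)
    · refine ⟨h, ?_⟩
      have := L.mul_mem (L.mul_mem (L.inv_mem (hsq i h1 h2)) h) (hsq i h1 h2)
      convert this using 1
      group
    · refine ⟨?_, h⟩
      have := L.mul_mem (L.mul_mem (hsq i h1 h2) h) (L.inv_mem (hsq i h1 h2))
      convert this using 1
      group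
  have hgen : ∀ i, 1 ≤ i → i < n → ∀ k j, 1 ≤ k → k ≤ j → j < n →
      s i * pureGen s k j * (s i)⁻¹ ∈ L ∧ (s i)⁻¹ * pureGen s k j * s i ∈ L := by
    intro i h1 h2 k j hk hkj hj
    apply hone i h1 h2
    by_cases c1 : i + 1 < k ∨ j + 1 < i ∨ (k < i ∧ i < j) ∨ (i = k ∧ i = j)
    · left
      rw [(hs.commute_pureGen h1 h2 hk hkj hj c1).eq, mul_inv_cancel_right]
      exact hmem k j hk hkj hj
    · have c2 : i + 1 = k ∨ (i = k ∧ k < j) ∨ (i = j ∧ k < j) ∨ i = j + 1 := by omega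
      rcases c2 with rfl | ⟨rfl, h⟩ | ⟨rfl, h⟩ | rfl
      · left
        rw [conj_pureGen_left i j (by omega)]
        exact hmem _ _ h1 (by omega) hj
      · right
        rw [← conj_pureGen_left i j h]
        convert hmem (i + 1) j (by omega) h hj using 1
        group
      · left
        obtain ⟨i, rfl⟩ : ∃ l, i = l + 1 := ⟨i - 1, by omega⟩
        rw [hs.conj_pureGen_right hk (by omega) hj]
        exact hmem _ _ hk (by omega) (by omega)
      · right
        rw [← hs.conj_pureGen_right hk hkj h2]
        convert hmem k (j + 1) hk (by omega) h2 using 1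
        group
  rw [← Subgroup.normalizer_eq_top_iff, eq_top_iff, ← htop, Subgroup.closure_le]
  rintro _ ⟨i, h1, h2, rfl⟩
  have hc1 : L ≤ L.comap (MulAut.conj (s i)).toMonoidHom := by
    conv_lhs => rw [hL]
    rw [Subgroup.closure_le]
    rintro _ ⟨k, j, hk, hkj, hj, rfl⟩
    exact (hgen i h1 h2 k j hk hkj hj).1
  have hc2 : L ≤ L.comap (MulAut.conj (s i)⁻¹).toMonoidHom := by
    conv_lhs => rw [hL]
    rw [Subgroup.closure_le]
    rintro _ ⟨k, j, hk, hkj, hj, rfl⟩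
    simpa using (hgen i h1 h2 k j hk hkj hj).2
  rw [SetLike.mem_coe, Subgroup.mem_normalizer_iff]
  intro g
  refine ⟨fun h => hc1 h, fun h => ?_⟩
  have := hc2 h
  simpa [mul_assoc] using this

end IsArtin

/-! ### Adjacent transpositions -/

theorem adj_apply_left {n i : ℕ} (h : i + 1 < n) :
    adj n (i + 1) ⟨i, by omega⟩ = ⟨i + 1, h⟩ := by
  rw [adj, dif_pos ⟨by omega, h⟩]
  exact Equiv.swap_apply_left _ _

theorem adj_apply_right {n i : ℕ} (h : i + 1 < n) :
    adj n (i + 1) ⟨i + 1, h⟩ = ⟨i, by omega⟩ := by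
  rw [adj, dif_pos ⟨by omega, h⟩]
  exact Equiv.swap_apply_right _ _

theorem adj_apply_of_ne {n i : ℕ} {x : Fin n} (h : x.1 + 1 ≠ i) (h' : x.1 ≠ i) :
    adj n i x = x := by
  unfold adj
  split_ifs with hi
  · apply Equiv.swap_apply_of_ne_of_ne <;> simp only [ne_eq, Fin.ext_iff] <;> omega
  · rfl

theorem apply_eq_of_mem_closure {n : ℕ} {T : Set (Equiv.Perm (Fin n))} {x : Fin n}
    (hT : ∀ π ∈ T, π x = x) {π : Equiv.Perm (Fin n)} (hπ : π ∈ Subgroup.closure T) : π x = x := by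
  have : Subgroup.closure T ≤ MulAction.stabilizer (Equiv.Perm (Fin n)) x := by
    rw [Subgroup.closure_le]
    exact fun π h => hT π h
  exact this hπ

theorem desc_adj_apply {n k j : ℕ} (h : k ≤ j) (hj : j < n) :
    desc (adj n) k j ⟨k, by omega⟩ = ⟨j, hj⟩ := by
  induction j, h using Nat.le_induction with
  | base => simp
  | succ j h ih =>
    rw [desc_succ _ h, Equiv.Perm.mul_apply, ih (by omega), adj_apply_left]

theorem desc_adj_apply_of_lt {n k j : ℕ} {x : Fin n} (h : x.1 < k) :
    desc (adj n) k j x = x := by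
  refine apply_eq_of_mem_closure (T := {π | ∃ i, k < i ∧ π = adj n i}) ?_
    (desc_mem fun i h h' => Subgroup.subset_closure ⟨i, h, rfl⟩)
  rintro _ ⟨i, hi, rfl⟩
  exact adj_apply_of_ne (by omega) (by omega)

/-- A permutation that fixes the first `k` points is a product of the adjacent transpositions of
the other points. -/
theorem mem_closure_adj {n k : ℕ} (hk : k ≤ n) {π : Equiv.Perm (Fin n)}
    (hπ : ∀ x : Fin n, x.1 < k → π x = x) :
    π ∈ Subgroup.closure {π | ∃ i, k < i ∧ i < n ∧ π = adj n i} := by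
  induction hk using Nat.decreasingInduction generalizing π with
  | self =>
    have : π = 1 := Equiv.ext fun x => hπ x x.2
    rw [this]
    exact Subgroup.one_mem _
  | of_succ k hk ih =>
    obtain ⟨m, hm⟩ : ∃ m, m = π ⟨k, hk⟩ := ⟨_, rfl⟩
    have hkm : k ≤ m.1 := by
      by_contra! h
      have h1 := π.injective (hm.symm.trans (hπ m h).symm)
      rw [← h1] at h
      exact lt_irrefl _ h
    have hd : desc (adj n) k m ∈ Subgroup.closure {π | ∃ i, k < i ∧ i < n ∧ π = adj n i} :=
      desc_mem fun i h h' => Subgroup.subset_closure ⟨i, h, by omega, rfl⟩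
    have h2 : (desc (adj n) k m)⁻¹ * π ∈
        Subgroup.closure {π | ∃ i, k + 1 < i ∧ i < n ∧ π = adj n i} := by
      refine ih fun x hx => ?_
      rw [Equiv.Perm.mul_apply, Equiv.Perm.inv_eq_iff_eq]
      rcases Nat.lt_succ_iff_lt_or_eq.1 hx with h | h
      · rw [hπ x h, desc_adj_apply_of_lt h]
      · obtain rfl : x = ⟨k, hk⟩ := Fin.ext h
        rw [← hm, desc_adj_apply hkm m.2]
    have h3 := Subgroup.mul_mem _ hd (Subgroup.closure_mono (by
      rintro _ ⟨i, h, h', rfl⟩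
      exact ⟨i, by omega, h', rfl⟩) h2)
    simpa using h3

/-! ### Generators of the pure braid group -/

namespace IsArtin

variable {G : Type*} [Group G] {n : ℕ} {s : ℕ → G}

/-- If the letters are involutions, then every product of `s 1, …, s m` is a product of
`s 1, …, s (m-1)` followed by a descending word `s m ⋯ s (k+1)`. -/
theorem exists_eq_mul_desc (hs : IsArtin n s) (hsq : ∀ i, 1 ≤ i → i < n → s i * s i = 1) {m : ℕ}
    (hm : m < n) {g : G} (hg : g ∈ Subgroup.closure {g | ∃ i, 1 ≤ i ∧ i ≤ m ∧ g = s i}) :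
    ∃ k ≤ m, ∃ h ∈ Subgroup.closure {g | ∃ i, 1 ≤ i ∧ i < m ∧ g = s i}, g = h * desc s k m := by
  have step : ∀ k ≤ m, ∀ h ∈ Subgroup.closure {g | ∃ i, 1 ≤ i ∧ i < m ∧ g = s i}, ∀ i, 1 ≤ i →
      i ≤ m → ∃ k' ≤ m, ∃ h' ∈ Subgroup.closure {g | ∃ i, 1 ≤ i ∧ i < m ∧ g = s i},
        h * desc s k m * s i = h' * desc s k' m := by
    intro k hk h hh i h1 h2
    have hmem : ∀ i, 1 ≤ i → i < m → s i ∈ Subgroup.closure {g | ∃ i, 1 ≤ i ∧ i < m ∧ g = s i} :=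
      fun i h1 h2 => Subgroup.subset_closure ⟨i, h1, h2, rfl⟩
    have hc : i < k ∨ i = k ∨ i = k + 1 ∨ k + 1 < i := by omega
    rcases hc with hc | rfl | rfl | hc
    · have h3 : Commute (s i) (desc s k m) := commute_desc fun l h h' =>
        hs.commute (by omega) (by omega) (by omega) (by omega) (by omega)
      exact ⟨k, hk, h * s i, Subgroup.mul_mem _ hh (hmem i h1 (by omega)), by
        rw [mul_assoc, ← h3.eq, mul_assoc]⟩
    · obtain ⟨i, rfl⟩ : ∃ l, i = l + 1 := ⟨i - 1, by omega⟩
      exact ⟨i, by omega, h, hh, by rw [desc_eq_mul s (show i < m by omega), mul_assoc]⟩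
    · exact ⟨k + 1, h2, h, hh, by
        rw [desc_eq_mul s (show k < m by omega), mul_assoc, mul_assoc, hsq _ h1 (by omega),
          mul_one]⟩
    · obtain ⟨i, rfl⟩ : ∃ l, i = l + 1 := ⟨i - 1, by omega⟩
      exact ⟨k, hk, h * s i, Subgroup.mul_mem _ hh (hmem i (by omega) (by omega)), by
        rw [mul_assoc, hs.desc_mul (by omega) h2 hm, mul_assoc]⟩
  induction hg using Subgroup.closure_induction_right with
  | one => exact ⟨m, le_rfl, 1, Subgroup.one_mem _, by simp⟩
  | mul_right g hg y hy ih =>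
    obtain ⟨i, h1, h2, rfl⟩ := hy
    obtain ⟨k, hk, h, hh, rfl⟩ := ih
    exact step k hk h hh i h1 h2
  | mul_inv_cancel g hg y hy ih =>
    obtain ⟨i, h1, h2, rfl⟩ := hy
    obtain ⟨k, hk, h, hh, rfl⟩ := ih
    rw [inv_eq_of_mul_eq_one_left (hsq i h1 (by omega))]
    exact step k hk h hh i h1 h2

/-- If the letters are involutions, then a product of letters with trivial permutation is
trivial: the Artin relations and the relations `s i ^ 2 = 1` present the symmetric group. -/
theorem eq_one_of_perm_eq_one (hs : IsArtin n s) (hsq : ∀ i, 1 ≤ i → i < n → s i * s i = 1)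
    (π : G →* Equiv.Perm (Fin n)) (hπ : ∀ i, 1 ≤ i → i < n → π (s i) = adj n i) {m : ℕ}
    (hm : m ≤ n) {g : G} (hg : g ∈ Subgroup.closure {g | ∃ i, 1 ≤ i ∧ i < m ∧ g = s i})
    (h1 : π g = 1) : g = 1 := by
  induction m generalizing g with
  | zero =>
    have : {g | ∃ i, 1 ≤ i ∧ i < 0 ∧ g = s i} = ∅ := by ext; simp
    rw [this, Subgroup.closure_empty] at hg
    exact hg
  | succ m ih =>
    simp only [Nat.lt_succ_iff] at hg
    obtain ⟨k, hk, h, hh, rfl⟩ := hs.exists_eq_mul_desc hsq hm hg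
    have h2 : π h ⟨m, hm⟩ = ⟨m, hm⟩ := by
      refine apply_eq_of_mem_closure (T := π '' {g | ∃ i, 1 ≤ i ∧ i < m ∧ g = s i}) ?_ ?_
      · rintro _ ⟨_, ⟨i, hi, hi', rfl⟩, rfl⟩
        rw [hπ i hi (by omega)]
        exact adj_apply_of_ne (by simp only; omega) (by simp only; omega)
      · rw [← MonoidHom.map_closure]
        exact ⟨h, hh, rfl⟩
    have h3 : π (desc s k m) ⟨k, by omega⟩ = ⟨m, hm⟩ := by
      have : π (desc s k m) = desc (adj n) k m := by
        rw [map_desc, desc, desc]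
        congr 1
        refine List.map_congr_left fun i hi => hπ i ?_ ?_ <;>
        · rw [List.mem_reverse, List.mem_range'_1] at hi
          omega
      rw [this, desc_adj_apply hk]
    have h4 : k = m := by
      have := DFunLike.congr_fun h1 ⟨k, by omega⟩
      rw [map_mul, Equiv.Perm.mul_apply, h3, h2, Equiv.Perm.one_apply, Fin.mk.injEq] at this
      exact this.symm
    subst h4
    rw [desc_self, mul_one] at h1 ⊢
    exact ih (by omega) hh h1

end IsArtin

/-- The element `σ_i` of the braid group. -/
def braidSigma (n i : ℕ) : B n := PresentedGroup.mk _ (braidLetter n i)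

theorem braidSigma_of {n i : ℕ} (h : 1 ≤ i) (h' : i < n) :
    braidSigma n i = PresentedGroup.of (.sigma i h h') := by
  rw [braidSigma, braidLetter, dif_pos ⟨h, h'⟩]
  rfl

theorem isArtin_braidSigma (n : ℕ) : IsArtin n (braidSigma n) where
  braid i h h' := PresentedGroup.mk_eq_mk_of_mul_inv_mem (Or.inl ⟨i, h, h', rfl⟩)
  comm i j h h' h'' := PresentedGroup.mk_eq_mk_of_mul_inv_mem (Or.inr ⟨i, j, h, h', h'', rfl⟩)

theorem closure_braidSigma (n : ℕ) :
    Subgroup.closure {g | ∃ i, 1 ≤ i ∧ i < n ∧ g = braidSigma n i} = ⊤ := by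
  rw [eq_top_iff, ← PresentedGroup.closure_range_of, Subgroup.closure_le]
  rintro _ ⟨⟨i, h, h'⟩, rfl⟩
  exact Subgroup.subset_closure ⟨i, h, h', (braidSigma_of h h').symm⟩

@[simp]
theorem braidPerm_braidSigma (n i : ℕ) : braidPerm n (braidSigma n i) = adj n i :=
  braidLetter_perm n i

@[simp]
theorem braidToSG_braidSigma (n i : ℕ) : braidToSG n (braidSigma n i) = sigma n i :=
  braidLetter_SG n i

/-- The pure braid group is generated by the `a_{k,j}`. -/
theorem closure_pureGen_braidSigma (n : ℕ) :
    Subgroup.closure {g | ∃ k j, 1 ≤ k ∧ k ≤ j ∧ j < n ∧ g = pureGen (braidSigma n) k j} = P n := by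
  have hs := isArtin_braidSigma n
  have hN := hs.normal_closure_pureGen (closure_braidSigma n)
  set L := Subgroup.closure {g | ∃ k j, 1 ≤ k ∧ k ≤ j ∧ j < n ∧ g = pureGen (braidSigma n) k j}
    with hL
  have hle : L ≤ P n := by
    rw [hL, Subgroup.closure_le]
    rintro _ ⟨k, j, hk, hkj, hj, rfl⟩
    rw [P, SetLike.mem_coe, MonoidHom.mem_ker, pureGen]
    simp [pow_two, adj_sq]
  refine le_antisymm hle fun b hb => ?_
  rw [← QuotientGroup.eq_one_iff]
  have hs' : IsArtin n (fun i => (braidSigma n i : B n ⧸ L)) :=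
    ⟨fun i h h' => congrArg (QuotientGroup.mk' L) (hs.braid i h h'),
      fun i j h h' h'' => congrArg (QuotientGroup.mk' L) (hs.comm i j h h' h'')⟩
  refine hs'.eq_one_of_perm_eq_one (fun i h h' => ?_) (QuotientGroup.lift L (braidPerm n) hle)
    (fun i h h' => ?_) le_rfl ?_ hb
  · rw [← QuotientGroup.mk_mul, QuotientGroup.eq_one_iff, ← pow_two]
    exact Subgroup.subset_closure ⟨i, i, h, le_rfl, h', by simp [pureGen]⟩
  · exact braidPerm_braidSigma n i
  · have hb' : b ∈ Subgroup.closure {g | ∃ i, 1 ≤ i ∧ i < n ∧ g = braidSigma n i} := by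
      rw [closure_braidSigma]; trivial
    have := Subgroup.mem_map_of_mem (QuotientGroup.mk' L) hb'
    rw [MonoidHom.map_closure] at this
    refine Subgroup.closure_mono ?_ this
    rintro _ ⟨_, ⟨i, h, h', rfl⟩, rfl⟩
    exact ⟨i, h, h', rfl⟩

/-! ### Identities in the braid group on four strands -/

section BraidIdentities

variable {G : Type*} [Group G] {x y z t : G}

theorem commute_full_twist (h : x * y * x = y * x * y) : Commute x (y * x ^ 2 * y) := by
  show _ = _
  calc x * (y * x ^ 2 * y) = (x * y * x) * (x * y) := by simp only [pow_two, mul_assoc]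
    _ = y * x * (y * x * y) := by rw [h]; simp only [mul_assoc]
    _ = y * x ^ 2 * y * x := by rw [← h]; simp only [pow_two, mul_assoc]

/-- The braid that crosses the strands 1, 2 over the strands 3, 4 conjugates the first generator
into the third. -/
theorem cross_mul_left (hxy : x * y * x = y * x * y) (hyz : y * z * y = z * y * z) :
    y * z * x * y * x = z * (y * z * x * y) := by
  calc y * z * x * y * x = y * z * (x * y * x) := by simp only [mul_assoc]
    _ = (y * z * y) * (x * y) := by rw [hxy]; simp only [mul_assoc]
    _ = z * (y * z * x * y) := by rw [hyz]; simp only [mul_assoc]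

theorem cross_mul_right (hxy : x * y * x = y * x * y) (hyz : y * z * y = z * y * z)
    (hxz : x * z = z * x) : y * z * x * y * z = x * (y * z * x * y) := by
  calc y * z * x * y * z = y * (z * x) * y * z := by simp only [mul_assoc]
    _ = y * x * (z * y * z) := by rw [← hxz]; simp only [mul_assoc]
    _ = (y * x * y) * (z * y) := by rw [← hyz]; simp only [mul_assoc]
    _ = x * (y * (x * z) * y) := by rw [← hxy]; simp only [mul_assoc]
    _ = x * (y * z * x * y) := by rw [hxz]; simp only [mul_assoc]

/-- The square of the crossing braid in terms of elements that commute with the first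
generator. -/
theorem cross_mul_cross (hxy : x * y * x = y * x * y) (hyz : y * z * y = z * y * z)
    (hxz : x * z = z * x) :
    (y * z * x * y) * (y * z * x * y) = z⁻¹ * (y * x ^ 2 * y) * z * (y * x ^ 2 * y) := by
  have h1 : (y * x ^ 2 * y) * z * (y * x ^ 2 * y) =
      (y * z * x * y) * x * (y * z * x * y) := by
    calc (y * x ^ 2 * y) * z * (y * x ^ 2 * y)
        = y * x * x * (y * z * y) * x * x * y := by simp only [pow_two, mul_assoc]
      _ = y * x * (x * z) * y * (z * x) * x * y := by rw [hyz]; simp only [mul_assoc]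
      _ = y * x * (z * x) * y * (x * z) * x * y := by rw [hxz]
      _ = y * (x * z) * (x * y * x) * z * x * y := by simp only [mul_assoc]
      _ = y * (z * x) * (y * x * y) * z * x * y := by rw [hxz, hxy]
      _ = _ := by simp only [mul_assoc]
  rw [cross_mul_left hxy hyz] at h1
  simp only [mul_assoc] at h1 ⊢
  rw [h1, inv_mul_cancel_left]

/-- In the presence of the other relations, the last defining relation of the singular braid
group says that `x t` commutes with its conjugate by the crossing braid. -/
theorem cross_relation_iff (hxy : x * y * x = y * x * y) (hyz : y * z * y = z * y * z)
    (hxz : x * z = z * x) (hzt : z * t = t * z)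
    (hwt : y * x ^ 2 * y * t = t * (y * x ^ 2 * y)) :
    y * z * x * y * t * (y * z * x * y) * t = t * (y * z * x * y) * t * (y * z * x * y) ↔
      Commute (x * t) ((y * z * x * y) * (x * t) * (y * z * x * y)⁻¹) := by
  have h1 := cross_mul_left hxy hyz
  have h2 := cross_mul_right hxy hyz hxz
  have h3 : Commute ((y * z * x * y) * (y * z * x * y)) t := by
    rw [cross_mul_cross hxy hyz hxz]
    have hz : Commute z t := hzt
    have hw : Commute (y * x ^ 2 * y) t := hwt
    exact ((hz.inv_left.mul_left hw).mul_left hz).mul_left hw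
  generalize y * z * x * y = D at *
  obtain ⟨t', ht'⟩ : ∃ t', t' = D * t * D⁻¹ := ⟨_, rfl⟩
  have e1 : D * (x * t) * D⁻¹ = z * t' := by
    rw [← mul_assoc, h1, ht']
    simp only [mul_assoc]
  have c1 : Commute x z := hxz
  have c2 : Commute x t' := by
    have : x = D * z * D⁻¹ := by rw [h2, mul_inv_cancel_right]
    have hz : Commute z t := hzt
    rw [ht', this]
    exact hz.conj D
  have c3 : Commute t z := hzt.symm
  have e2 : Commute (x * t) (z * t') ↔ Commute t t' := by
    constructor
    · intro h
      have h4 : Commute (x⁻¹ * (x * t)) (z⁻¹ * (z * t')) := by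
        have a1 : Commute x⁻¹ (z * t') := (c1.mul_right c2).inv_left
        have a2 : Commute (x * t) z⁻¹ := (c1.mul_left c3).inv_right
        have a3 : Commute x⁻¹ z⁻¹ := c1.inv_inv
        exact (a3.mul_right a1).mul_left (a2.mul_right h)
      simpa using h4
    · intro h
      exact (c1.mul_right c2).mul_left (c3.mul_right h)
  rw [e1, e2]
  have e3 : D * t * D * t = t' * t * (D * D) := by
    calc D * t * D * t = D * t * D⁻¹ * (D * D * t) := by group
      _ = _ := by rw [h3.eq, ht']; group
  have e4 : t * D * t * D = t * t' * (D * D) := by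
    rw [ht']; group
  rw [e3, e4, mul_left_inj]
  exact eq_comm

end BraidIdentities

/-! ### The singular braid group as an extension of the braid group -/

theorem isArtin_sigma (n : ℕ) : IsArtin n (sigma n) where
  braid i h h' := by
    simpa using congrArg (braidToSG n) ((isArtin_braidSigma n).braid i h h')
  comm i j h h' h'' := by
    simpa using congrArg (braidToSG n) ((isArtin_braidSigma n).comm i j h h' h'')

theorem commute_sigma_tau {n i : ℕ} (h : 1 ≤ i) (h' : i < n) (h2 : i ≠ 2) :
    sigma n i * tau n 1 = tau n 1 * sigma n i :=
  PresentedGroup.mk_eq_mk_of_mul_inv_mem (Or.inr (Or.inr (Or.inl ⟨i, h, h', h2, rfl⟩)))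

theorem full_twist_mul_tau {n : ℕ} (h : 3 ≤ n) :
    sigma n 2 * sigma n 1 ^ 2 * sigma n 2 * tau n 1 =
      tau n 1 * (sigma n 2 * sigma n 1 ^ 2 * sigma n 2) :=
  PresentedGroup.mk_eq_mk_of_mul_inv_mem (Or.inr (Or.inl ⟨h, rfl⟩))

theorem cross_mul_tau {n : ℕ} (h : 4 ≤ n) :
    sigma n 2 * sigma n 3 * sigma n 1 * sigma n 2 * tau n 1 *
        (sigma n 2 * sigma n 3 * sigma n 1 * sigma n 2) * tau n 1 =
      tau n 1 * (sigma n 2 * sigma n 3 * sigma n 1 * sigma n 2) * tau n 1 *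
        (sigma n 2 * sigma n 3 * sigma n 1 * sigma n 2) :=
  PresentedGroup.mk_eq_mk_of_mul_inv_mem (Or.inr (Or.inr (Or.inr ⟨h, rfl⟩)))

/-- The subgroup of the braid group generated by the elements that commute with `τ_1` according to
the defining relations. -/
def tauStabilizer (n : ℕ) : Subgroup (B n) :=
  Subgroup.closure {g | (∃ i, 1 ≤ i ∧ i < n ∧ i ≠ 2 ∧ g = braidSigma n i) ∨
    (3 ≤ n ∧ g = braidSigma n 2 * braidSigma n 1 ^ 2 * braidSigma n 2)}

/-- The vertices index the conjugates of `σ_1 τ_1` by braids. -/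
abbrev Vertex (n : ℕ) : Type := B n ⧸ tauStabilizer n

/-- The braid `σ_2 σ_3 σ_1 σ_2`. -/
def cross (n : ℕ) : B n :=
  braidSigma n 2 * braidSigma n 3 * braidSigma n 1 * braidSigma n 2

/-- The pairs of vertices whose conjugates of `σ_1 τ_1` commute by a conjugate of the last
defining relation of the singular braid group. -/
def Edge (n : ℕ) (v w : Vertex n) : Prop :=
  4 ≤ n ∧ ∃ g : B n, (v = (g : Vertex n) ∧ w = (g * cross n : B n)) ∨
    (v = (g * cross n : B n) ∧ w = (g : Vertex n))

theorem Edge.symm {n : ℕ} {v w : Vertex n} (h : Edge n v w) : Edge n w v := by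
  obtain ⟨hn, g, h⟩ := h
  exact ⟨hn, g, h.symm.imp And.symm And.symm⟩

theorem Edge.smul {n : ℕ} (b : B n) (v w : Vertex n) (h : Edge n v w) :
    Edge n (b • v) (b • w) := by
  obtain ⟨hn, g, ⟨rfl, rfl⟩ | ⟨rfl, rfl⟩⟩ := h
  · exact ⟨hn, b * g, Or.inl ⟨rfl, by rw [mul_assoc]; rfl⟩⟩
  · exact ⟨hn, b * g, Or.inr ⟨by rw [mul_assoc]; rfl, rfl⟩⟩

theorem commute_tauStabilizer {n : ℕ} {c : B n} (hc : c ∈ tauStabilizer n) :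
    Commute (braidToSG n c) (sigma n 1 * tau n 1) := by
  have : tauStabilizer n ≤
      (Subgroup.centralizer {sigma n 1 * tau n 1}).comap (braidToSG n) := by
    rw [tauStabilizer, Subgroup.closure_le]
    rintro _ (⟨i, h, h', h2, rfl⟩ | ⟨h, rfl⟩)
    · rw [Subgroup.coe_comap, Set.mem_preimage, SetLike.mem_coe,
        Subgroup.mem_centralizer_singleton_iff, braidToSG_braidSigma]
      have h1 : Commute (sigma n i) (sigma n 1) :=
        (isArtin_sigma n).commute h h' le_rfl (by omega) (by omega)
      exact (h1.mul_right (commute_sigma_tau h h' h2)).eq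
    · rw [Subgroup.coe_comap, Set.mem_preimage, SetLike.mem_coe,
        Subgroup.mem_centralizer_singleton_iff]
      simp only [map_mul, map_pow, braidToSG_braidSigma]
      have h1 := (commute_full_twist ((isArtin_sigma n).braid 1 le_rfl (by omega))).symm
      exact h1.mul_right (full_twist_mul_tau h)
  exact Subgroup.mem_centralizer_singleton_iff.1 (this hc)

/-- The conjugate of `σ_1 τ_1` at a vertex. -/
def singularConj (n : ℕ) : Vertex n → SG n :=
  Quotient.lift (fun g => braidToSG n g * (sigma n 1 * tau n 1) * (braidToSG n g)⁻¹) (by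
    intro g g' h
    have h1 := (commute_tauStabilizer (QuotientGroup.leftRel_apply.1 h)).eq
    rw [map_mul, map_inv] at h1
    calc braidToSG n g * (sigma n 1 * tau n 1) * (braidToSG n g)⁻¹
        = braidToSG n g * ((sigma n 1 * tau n 1) * ((braidToSG n g)⁻¹ * braidToSG n g')) *
            (braidToSG n g')⁻¹ := by group
      _ = _ := by rw [← h1]; group)

theorem singularConj_mk {n : ℕ} (g : B n) : singularConj n (g : Vertex n) =
    braidToSG n g * (sigma n 1 * tau n 1) * (braidToSG n g)⁻¹ := rfl

theorem singularConj_smul {n : ℕ} (b : B n) (v : Vertex n) :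
    singularConj n (b • v) = braidToSG n b * singularConj n v * (braidToSG n b)⁻¹ := by
  induction v using QuotientGroup.induction_on with
  | H g =>
    rw [MulAction.Quotient.smul_coe, singularConj_mk, singularConj_mk, smul_eq_mul, map_mul]
    group

theorem commute_singularConj {n : ℕ} {v w : Vertex n} (h : Edge n v w) :
    Commute (singularConj n v) (singularConj n w) := by
  obtain ⟨hn, g, h⟩ := h
  have hs := isArtin_sigma n
  have h1 := (cross_relation_iff (hs.braid 1 le_rfl (by omega)) (hs.braid 2 (by omega) (by omega))
    (hs.comm 1 3 le_rfl (by omega) (by omega))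
    (commute_sigma_tau (show 1 ≤ 3 by omega) (by omega) (by omega))
    (full_twist_mul_tau (by omega))).1 (cross_mul_tau hn)
  have h2 : Commute (singularConj n (g : Vertex n)) (singularConj n (g * cross n : B n)) := by
    have := h1.conj (braidToSG n g)
    rw [singularConj_mk, singularConj_mk]
    convert this using 1
    simp only [cross, map_mul, braidToSG_braidSigma]
    group
  rcases h with ⟨rfl, rfl⟩ | ⟨rfl, rfl⟩
  · exact h2
  · exact h2.symm

/-- The semidirect product of the graph group on the vertices by the braid group. -/
abbrev Model (n : ℕ) : Type :=
  GraphGroup (Edge n) ⋊[GraphGroup.action (Edge.smul (n := n))] B n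

theorem Model.conj_gen {n : ℕ} (b : B n) (v : Vertex n) :
    (SemidirectProduct.inr b : Model n) * SemidirectProduct.inl (GraphGroup.gen (Edge n) v) *
      (SemidirectProduct.inr b)⁻¹ = SemidirectProduct.inl (GraphGroup.gen (Edge n) (b • v)) := by
  rw [← map_inv, ← SemidirectProduct.inl_aut, GraphGroup.action_gen]

theorem Model.commute_tauStabilizer {n : ℕ} {c : B n} (hc : c ∈ tauStabilizer n) :
    Commute (SemidirectProduct.inr c : Model n)
      (SemidirectProduct.inl (GraphGroup.gen (Edge n) ((1 : B n) : Vertex n))) := by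
  have h := Model.conj_gen c ((1 : B n) : Vertex n)
  have h1 : c • ((1 : B n) : Vertex n) = ((1 : B n) : Vertex n) := by
    rw [MulAction.Quotient.smul_coe, QuotientGroup.eq]
    simpa using hc
  rw [h1] at h
  exact mul_inv_eq_iff_eq_mul.1 h

/-- The image of `τ_1` in the model. -/
def Model.tau (n : ℕ) : Model n :=
  SemidirectProduct.inr (braidSigma n 1)⁻¹ *
    SemidirectProduct.inl (GraphGroup.gen (Edge n) ((1 : B n) : Vertex n))

/-- Where the generators of `SG_n` go in the model. -/
def Model.ofGen (n : ℕ) : SingGen n → Model n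
  | .sigma i _ _ => SemidirectProduct.inr (braidSigma n i)
  | .tau _ => Model.tau n

theorem Model.singLetter (n i : ℕ) : FreeGroup.lift (Model.ofGen n) (singLetter n i) =
    SemidirectProduct.inr (braidSigma n i) := by
  by_cases h : 1 ≤ i ∧ i < n
  · simp [SingBraid.singLetter, h, Model.ofGen]
  · rw [SingBraid.singLetter, braidSigma, braidLetter, dif_neg h, dif_neg h]
    simp

theorem Model.tauLetter {n : ℕ} (h : 2 ≤ n) :
    FreeGroup.lift (Model.ofGen n) (tauLetter n) = Model.tau n := by
  simp [SingBraid.tauLetter, h, Model.ofGen]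

theorem Model.isArtin (n : ℕ) :
    IsArtin n (fun i => (SemidirectProduct.inr (braidSigma n i) : Model n)) where
  braid i h h' := by
    simpa only [map_mul] using congrArg (SemidirectProduct.inr : B n →* Model n)
      ((isArtin_braidSigma n).braid i h h')
  comm i j h h' h'' := by
    simpa only [map_mul] using congrArg (SemidirectProduct.inr : B n →* Model n)
      ((isArtin_braidSigma n).comm i j h h' h'')

theorem Model.artinRels {n : ℕ} :
    ∀ r ∈ artinRels n (fun i => (SemidirectProduct.inr (braidSigma n i) : Model n)), r = 1 := by
  rintro r (⟨i, h₁, h₂, rfl⟩ | ⟨i, j, h₁, h₂, h₃, rfl⟩) <;> rw [mul_inv_eq_one]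
  · exact (Model.isArtin n).braid i h₁ h₂
  · exact (Model.isArtin n).comm i j h₁ h₂ h₃

theorem Model.sigma_mul_tau {n : ℕ} : (SemidirectProduct.inr (braidSigma n 1) : Model n) *
    Model.tau n = SemidirectProduct.inl (GraphGroup.gen (Edge n) ((1 : B n) : Vertex n)) := by
  rw [Model.tau, map_inv, mul_inv_cancel_left]

theorem Model.singRels {n : ℕ} :
    ∀ r ∈ singRels n (fun i => (SemidirectProduct.inr (braidSigma n i) : Model n))
      (Model.tau n), r = 1 := by
  have hs := Model.isArtin n
  have h1 : ∀ i, 1 ≤ i → i < n → i ≠ 2 →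
      Commute (SemidirectProduct.inr (braidSigma n i)) (Model.tau n) := by
    intro i h h' h2
    have := (hs.commute h h' le_rfl (by omega) (by omega)).inv_right
    rw [← map_inv] at this
    exact this.mul_right (Model.commute_tauStabilizer
      (Subgroup.subset_closure (Or.inl ⟨i, h, h', h2, rfl⟩)))
  have h2 : 3 ≤ n → Commute ((SemidirectProduct.inr (braidSigma n 2) : Model n) *
      SemidirectProduct.inr (braidSigma n 1) ^ 2 * SemidirectProduct.inr (braidSigma n 2))
      (Model.tau n) := by
    intro h
    have h3 := (commute_full_twist (hs.braid 1 le_rfl (by omega))).symm.inv_right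
    have h4 := Model.commute_tauStabilizer (n := n) (Subgroup.subset_closure (Or.inr ⟨h, rfl⟩))
    rw [← map_inv] at h3
    simp only [map_mul, map_pow] at h4
    exact h3.mul_right h4
  rintro r (⟨h, rfl⟩ | ⟨i, h, h', h'', rfl⟩ | ⟨h, rfl⟩) <;> rw [mul_inv_eq_one]
  · exact h2 h
  · exact h1 i h h' h''
  · refine (cross_relation_iff (hs.braid 1 le_rfl (by omega)) (hs.braid 2 (by omega) (by omega))
      (hs.comm 1 3 le_rfl (by omega) (by omega))
      (h1 3 (by omega) (by omega) (by omega)) (h2 (by omega))).2 ?_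
    have h3 := Model.conj_gen (cross n) ((1 : B n) : Vertex n)
    simp only [cross, map_mul] at h3
    rw [Model.sigma_mul_tau, h3]
    refine Commute.map (GraphGroup.commute_gen ⟨h, 1, Or.inl ⟨rfl, ?_⟩⟩) _
    rw [one_mul, MulAction.Quotient.smul_coe, smul_eq_mul, mul_one]
    rfl

/-- The homomorphism from the singular braid group to the model. -/
def toModel (n : ℕ) : SG n →* Model n :=
  PresentedGroup.toGroup (f := Model.ofGen n) (by
    rintro r (hr | hr)
    · have h := map_artinRels (FreeGroup.lift (Model.ofGen n)) n _ hr
      simp only [Model.singLetter] at h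
      exact Model.artinRels _ h
    · have hn : 2 ≤ n := by
        rcases hr with ⟨h, _⟩ | ⟨i, h, h', h'', _⟩ | ⟨h, _⟩
        · omega
        · rcases Nat.lt_or_ge 1 n with h | h <;> omega
        · omega
      have h := map_singRels (FreeGroup.lift (Model.ofGen n)) n _ _ hr
      simp only [Model.singLetter, Model.tauLetter hn] at h
      exact Model.singRels _ h)

theorem toModel_braidToSG {n : ℕ} (b : B n) :
    toModel n (braidToSG n b) = SemidirectProduct.inr b := by
  have : (toModel n).comp (braidToSG n) = SemidirectProduct.inr := by
    refine PresentedGroup.ext fun ⟨i, h, h'⟩ => ?_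
    rw [MonoidHom.comp_apply, ← braidSigma_of h h', braidToSG_braidSigma]
    exact Model.singLetter n i
  exact DFunLike.congr_fun this b

theorem braidToSG_injective (n : ℕ) : Function.Injective (braidToSG n) := fun b b' h =>
  SemidirectProduct.inr_injective (by rw [← toModel_braidToSG, h, toModel_braidToSG])

theorem toModel_tau {n : ℕ} (hn : 2 ≤ n) : toModel n (tau n 1) = Model.tau n :=
  Model.tauLetter hn

theorem toModel_singularConj {n : ℕ} (hn : 2 ≤ n) (v : Vertex n) :
    toModel n (singularConj n v) = SemidirectProduct.inl (GraphGroup.gen (Edge n) v) := by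
  induction v using QuotientGroup.induction_on with
  | H g =>
    rw [singularConj_mk, ← braidToSG_braidSigma]
    simp only [map_mul, map_inv, toModel_braidToSG, toModel_tau hn, Model.sigma_mul_tau,
      Model.conj_gen]
    rw [MulAction.Quotient.smul_coe, smul_eq_mul, mul_one]

/-! ### The pure singular braid group over the pure braid group -/

theorem singPerm_braidToSG {n : ℕ} (b : B n) : singPerm n (braidToSG n b) = braidPerm n b := by
  have : (singPerm n).comp (braidToSG n) = braidPerm n := by
    refine PresentedGroup.ext fun ⟨i, h, h'⟩ => ?_
    rw [MonoidHom.comp_apply, ← braidSigma_of h h', braidToSG_braidSigma, braidPerm_braidSigma]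
    exact singLetter_perm n i
  exact DFunLike.congr_fun this b

theorem singPerm_eq_braidPerm_right {n : ℕ} (s : SG n) :
    singPerm n s = braidPerm n (toModel n s).right := by
  have : singPerm n = (braidPerm n).comp (SemidirectProduct.rightHom.comp (toModel n)) := by
    refine PresentedGroup.ext fun x => ?_
    rw [MonoidHom.comp_apply, MonoidHom.comp_apply]
    refine (PresentedGroup.toGroup.of (singPerm_aux n)).trans ?_
    rw [toModel, PresentedGroup.toGroup.of]
    cases x with
    | sigma i h h' => simp [singGenPerm, Model.ofGen]
    | tau h =>
      simp only [singGenPerm, Model.ofGen, Model.tau, map_mul, SemidirectProduct.rightHom_inr,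
        SemidirectProduct.rightHom_inl, mul_one, map_inv, braidPerm_braidSigma]
      exact eq_inv_of_mul_eq_one_left (adj_sq n 1)
  exact DFunLike.congr_fun this s

theorem singularConj_mem_SGP {n : ℕ} (v : Vertex n) : singularConj n v ∈ SGP n := by
  induction v using QuotientGroup.induction_on with
  | H g =>
    have h1 : singPerm n (sigma n 1) = adj n 1 := singLetter_perm n 1
    have h2 : singPerm n (tau n 1) = adj n 1 := tauLetter_perm n
    have h3 : sigma n 1 * tau n 1 ∈ SGP n := by
      rw [SGP, MonoidHom.mem_ker, map_mul, h1, h2, adj_sq]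
    exact (MonoidHom.normal_ker (singPerm n)).conj_mem _ h3 _

/-- The inclusion of the pure braid group into the singular braid group. -/
def pureToSG (n : ℕ) : P n →* SG n := (braidToSG n).comp (P n).subtype

/-- The pure singular braid group is the extension of the graph group by the pure braid group. -/
theorem isGraphExtension_SGP {n : ℕ} (hn : 2 ≤ n) :
    IsGraphExtension (pureToSG n) (singularConj n) (Edge n) (SGP n) := by
  refine isGraphExtension_of_hom (braidToSG n) (singularConj n) (Edge n) Edge.smul
    singularConj_smul (fun v w => commute_singularConj) (toModel n) toModel_braidToSG
    (toModel_singularConj hn) (P n) (SGP n) (fun s hs => ?_) (fun q hq => ?_)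
    singularConj_mem_SGP
  · rw [P, MonoidHom.mem_ker, ← singPerm_eq_braidPerm_right]
    exact hs
  · rw [SGP, MonoidHom.mem_ker, singPerm_braidToSG]
    exact hq

/-- Every singular braid is a product of conjugates of `σ_1 τ_1` and their inverses, followed by a
braid. -/
theorem exists_eq_mul_braidToSG {n : ℕ} (s : SG n) :
    ∃ m ∈ Subgroup.closure (Set.range (singularConj n)), ∃ b : B n, s = m * braidToSG n b := by
  have hs : s ∈ Subgroup.closure (Set.range (PresentedGroup.of (rels := sgRels n))) := by
    rw [PresentedGroup.closure_range_of]; trivial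
  have hsigma : ∀ i h h', (PresentedGroup.of (.sigma i h h') : SG n) =
      braidToSG n (braidSigma n i) := by
    intro i h h'
    rw [braidToSG_braidSigma, sigma, singLetter, dif_pos ⟨h, h'⟩]
    rfl
  have htau : ∀ h, (PresentedGroup.of (.tau h) : SG n) =
      (braidToSG n (braidSigma n 1))⁻¹ * (sigma n 1 * tau n 1) := by
    intro h
    rw [braidToSG_braidSigma, inv_mul_cancel_left, tau, tauLetter, dif_pos h]
    rfl
  have hmem : ∀ b : B n, singularConj n b ∈ Subgroup.closure (Set.range (singularConj n)) :=
    fun b => Subgroup.subset_closure ⟨_, rfl⟩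
  induction hs using Subgroup.closure_induction_right with
  | one => exact ⟨1, Subgroup.one_mem _, 1, by simp⟩
  | mul_right s hs y hy ih =>
    obtain ⟨m, hm, b, rfl⟩ := ih
    obtain ⟨⟨i, h, h'⟩ | h, rfl⟩ := hy
    · exact ⟨m, hm, b * braidSigma n i, by rw [hsigma, map_mul, mul_assoc]⟩
    · refine ⟨_, Subgroup.mul_mem _ hm (hmem (b * (braidSigma n 1)⁻¹)),
        b * (braidSigma n 1)⁻¹, ?_⟩
      rw [htau, singularConj_mk, map_mul, map_inv]
      group
  | mul_inv_cancel s hs y hy ih =>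
    obtain ⟨m, hm, b, rfl⟩ := ih
    obtain ⟨⟨i, h, h'⟩ | h, rfl⟩ := hy
    · exact ⟨m, hm, b * (braidSigma n i)⁻¹, by rw [hsigma, map_mul, map_inv, mul_assoc]⟩
    · refine ⟨_, Subgroup.mul_mem _ hm (Subgroup.inv_mem _ (hmem b)), b * braidSigma n 1, ?_⟩
      rw [htau, singularConj_mk, map_mul]
      group

/-! ### Orbits of conjugates and pairs of strands -/

theorem map_adj_pair {n i : ℕ} (hn : 2 ≤ n) (hi : i ≠ 2) :
    Sym2.map (adj n i) s(⟨0, by omega⟩, ⟨1, hn⟩) = s(⟨0, by omega⟩, ⟨1, hn⟩) := by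
  by_cases h1 : i = 1
  · subst h1
    rw [Sym2.map_mk, adj_apply_left hn, adj_apply_right hn, Sym2.eq_swap]
  · by_cases h0 : i = 0
    · subst h0
      simp [adj]
    · rw [Sym2.map_mk, adj_apply_of_ne (by simp only; omega) (by simp only; omega),
        adj_apply_of_ne (by simp only; omega) (by simp only; omega)]

theorem map_tauStabilizer_pair {n : ℕ} (hn : 2 ≤ n) {c : B n} (hc : c ∈ tauStabilizer n) :
    Sym2.map (braidPerm n c) s(⟨0, by omega⟩, ⟨1, hn⟩) = s(⟨0, by omega⟩, ⟨1, hn⟩) := by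
  induction hc using Subgroup.closure_induction with
  | mem c h =>
    rcases h with ⟨i, h, h', h2, rfl⟩ | ⟨h, rfl⟩
    · rw [braidPerm_braidSigma]
      exact map_adj_pair hn h2
    · simp [pow_two, adj_sq]
  | one => simp
  | mul c d hc hd ihc ihd =>
    rw [map_mul, Equiv.Perm.coe_mul, Sym2.map_comp, Function.comp_apply, ihd, ihc]
  | inv c hc ih =>
    conv_lhs => rw [← ih]
    rw [Sym2.map_map, ← Equiv.Perm.coe_mul, ← map_mul]
    simp

/-- The pair of strands that are involved in the conjugate of `σ_1 τ_1` at a vertex. -/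
def strandPair {n : ℕ} (hn : 2 ≤ n) : Vertex n → Sym2 (Fin n) :=
  Quotient.lift (fun g => Sym2.map (braidPerm n g) s(⟨0, by omega⟩, ⟨1, hn⟩)) (by
    intro g g' h
    have h1 := map_tauStabilizer_pair hn (QuotientGroup.leftRel_apply.1 h)
    show Sym2.map (braidPerm n g) _ = Sym2.map (braidPerm n g') _
    rw [← h1, Sym2.map_map, ← Equiv.Perm.coe_mul, ← map_mul, mul_inv_cancel_left, h1])

theorem strandPair_mk {n : ℕ} (hn : 2 ≤ n) (g : B n) : strandPair hn (g : Vertex n) =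
    Sym2.map (braidPerm n g) s(⟨0, by omega⟩, ⟨1, hn⟩) := rfl

theorem strandPair_smul {n : ℕ} (hn : 2 ≤ n) (q : P n) (v : Vertex n) :
    strandPair hn (q • v) = strandPair hn v := by
  induction v using QuotientGroup.induction_on with
  | H g =>
    have h : braidPerm n q = 1 := q.2
    show strandPair hn ((q * g : B n) : Vertex n) = _
    rw [strandPair_mk, strandPair_mk, map_mul, h, one_mul]

/-- A permutation preserving the first pair of points comes from a braid that commutes with
`τ_1`. -/
theorem exists_mem_tauStabilizer {n : ℕ} (hn : 2 ≤ n) {π : Equiv.Perm (Fin n)}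
    (hπ : Sym2.map π s(⟨0, by omega⟩, ⟨1, hn⟩) = s(⟨0, by omega⟩, ⟨1, hn⟩)) :
    ∃ c ∈ tauStabilizer n, braidPerm n c = π := by
  have hle : Subgroup.closure {π | ∃ i, 2 < i ∧ i < n ∧ π = adj n i} ≤
      (tauStabilizer n).map (braidPerm n) := by
    rw [Subgroup.closure_le]
    rintro _ ⟨i, h, h', rfl⟩
    exact ⟨braidSigma n i, Subgroup.subset_closure (Or.inl ⟨i, by omega, h', by omega, rfl⟩),
      braidPerm_braidSigma n i⟩
  have hfix : ∀ π : Equiv.Perm (Fin n), π ⟨0, by omega⟩ = ⟨0, by omega⟩ → π ⟨1, hn⟩ = ⟨1, hn⟩ →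
      ∃ c ∈ tauStabilizer n, braidPerm n c = π := by
    intro π h0 h1
    refine hle (mem_closure_adj hn fun x hx => ?_)
    obtain ⟨x, hx'⟩ := x
    have hx2 : x = 0 ∨ x = 1 := by simp only at hx; omega
    rcases hx2 with rfl | rfl
    · exact h0
    · exact h1
  rw [Sym2.map_mk, Sym2.eq_iff] at hπ
  rcases hπ with ⟨h0, h1⟩ | ⟨h0, h1⟩
  · exact hfix π h0 h1
  · obtain ⟨c, hc, h⟩ := hfix (adj n 1 * π)
      (by rw [Equiv.Perm.mul_apply, h0, adj_apply_right hn])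
      (by rw [Equiv.Perm.mul_apply, h1, adj_apply_left hn])
    refine ⟨braidSigma n 1 * c, Subgroup.mul_mem _
      (Subgroup.subset_closure (Or.inl ⟨1, le_rfl, by omega, by omega, rfl⟩)) hc, ?_⟩
    rw [map_mul, h, braidPerm_braidSigma, ← mul_assoc, adj_sq, one_mul]

/-- The orbits of the pure braid group on the vertices are separated by the pairs of strands. -/
theorem exists_smul_eq_of_strandPair_eq {n : ℕ} (hn : 2 ≤ n) {v w : Vertex n}
    (h : strandPair hn v = strandPair hn w) : ∃ q : P n, q • v = w := by
  induction v using QuotientGroup.induction_on with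
  | H g =>
    induction w using QuotientGroup.induction_on with
    | H g' =>
      rw [strandPair_mk, strandPair_mk] at h
      obtain ⟨c, hc, h1⟩ := exists_mem_tauStabilizer hn (π := braidPerm n (g⁻¹ * g')) (by
        rw [map_mul, Equiv.Perm.coe_mul, ← Sym2.map_map, ← h, Sym2.map_map, ← Equiv.Perm.coe_mul,
          ← map_mul]
        simp)
      refine ⟨⟨g' * c⁻¹ * g⁻¹, ?_⟩, ?_⟩
      · rw [P, MonoidHom.mem_ker, map_mul, map_mul, map_inv, h1]
        simp
      · show ((g' * c⁻¹ * g⁻¹ * g : B n) : Vertex n) = _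
        rw [inv_mul_cancel_right]
        exact QuotientGroup.eq.2 (by simpa using hc)

theorem not_edge_of_strandPair_eq {n : ℕ} (hn : 2 ≤ n) {v w : Vertex n}
    (h : strandPair hn v = strandPair hn w) : ¬ Edge n v w := by
  rintro ⟨h4, g, hg⟩
  -- `cross n` takes the first two strands to the next two
  have h1 : strandPair hn (g : Vertex n) ≠ strandPair hn (g * cross n : B n) := by
    intro h
    rw [strandPair_mk, strandPair_mk, map_mul, Equiv.Perm.coe_mul, ← Sym2.map_map] at h
    have h2 := Sym2.map.injective (braidPerm n g).injective h
    have h3 : braidPerm n (cross n) ⟨0, by omega⟩ = ⟨2, by omega⟩ := by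
      simp only [cross, map_mul, braidPerm_braidSigma, Equiv.Perm.mul_apply]
      rw [adj_apply_of_ne (i := 2) (x := ⟨0, _⟩) (by simp) (by simp),
        adj_apply_left (i := 0) (by omega),
        adj_apply_of_ne (i := 3) (x := ⟨1, _⟩) (by simp) (by simp),
        adj_apply_left (i := 1) (by omega)]
    rw [Sym2.map_mk, h3] at h2
    simp at h2
  rcases hg with ⟨rfl, rfl⟩ | ⟨rfl, rfl⟩
  · exact h1 h
  · exact h1 h.symm

/-- A braid that conjugates `σ_1` and `τ_1` into `σ_i` and `τ_i`. -/
def shift (n : ℕ) : ℕ → B n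
  | 0 => 1
  | 1 => 1
  | i + 2 => braidSigma n (i + 1) * braidSigma n (i + 2) * shift n (i + 1)

theorem sigma_mul_tau_eq {n i : ℕ} (hi : i + 1 < n) : sigma n (i + 1) * tau n (i + 1) =
    braidToSG n (shift n (i + 1)) * (sigma n 1 * tau n 1) *
      (braidToSG n (shift n (i + 1)))⁻¹ := by
  induction i with
  | zero => simp [shift]
  | succ i ih =>
    have h := (isArtin_sigma n).braid (i + 1) (by omega) hi
    have h1 : sigma n (i + 2) =
        sigma n (i + 1) * sigma n (i + 2) * sigma n (i + 1) * (sigma n (i + 2))⁻¹ *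
          (sigma n (i + 1))⁻¹ := by
      rw [h]; group
    have h2 : sigma n (i + 2) * tau n (i + 2) = sigma n (i + 1) * sigma n (i + 2) *
        (sigma n (i + 1) * tau n (i + 1)) * (sigma n (i + 1) * sigma n (i + 2))⁻¹ := by
      conv_lhs => rw [h1, tau]
      group
    rw [h2, ih (by omega), shift]
    simp only [map_mul, braidToSG_braidSigma]
    group

theorem braidPerm_shift {n i : ℕ} (hi : i + 1 < n) :
    braidPerm n (shift n (i + 1)) ⟨0, by omega⟩ = ⟨i, by omega⟩ ∧
      braidPerm n (shift n (i + 1)) ⟨1, by omega⟩ = ⟨i + 1, hi⟩ := by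
  induction i with
  | zero => simp [shift]
  | succ i ih =>
    obtain ⟨h0, h1⟩ := ih (by omega)
    rw [shift]
    simp only [map_mul, Equiv.Perm.mul_apply, braidPerm_braidSigma, h0, h1]
    constructor
    · rw [adj_apply_of_ne (i := i + 2) (x := ⟨i, _⟩) (by simp) (by simp), adj_apply_left]
    · rw [adj_apply_left (i := i + 1) hi,
        adj_apply_of_ne (i := i + 1) (x := ⟨i + 2, _⟩) (by simp) (by simp)]

/-- The vertex of the singular generator `X_{k,j}`. -/
def idxVertex {n : ℕ} (p : Idx n) : Vertex n :=
  (desc (braidSigma n) p.1.1 p.1.2 * shift n p.1.1 : B n)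

theorem X_eq_singularConj {n : ℕ} (p : Idx n) : X p = singularConj n (idxVertex p) := by
  obtain ⟨⟨k, j⟩, hk, hkj, hj⟩ := p
  simp only at hk hkj hj
  obtain ⟨k, rfl⟩ : ∃ l, k = l + 1 := ⟨k - 1, by omega⟩
  have hd : braidToSG n (desc (braidSigma n) (k + 1) j) = descending n (k + 1) j := by
    rw [map_desc]
    simp only [braidToSG_braidSigma]
    rfl
  rw [idxVertex, singularConj_mk, X, map_mul, hd, mul_assoc (descending _ _ _),
    sigma_mul_tau_eq (by omega)]
  group

theorem strandPair_idxVertex {n : ℕ} (hn : 2 ≤ n) (p : Idx n) :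
    strandPair hn (idxVertex p) =
      s(⟨p.1.1 - 1, by have := p.2; omega⟩, ⟨p.1.2, p.2.2.2⟩) := by
  obtain ⟨⟨k, j⟩, hk, hkj, hj⟩ := p
  simp only at hk hkj hj
  obtain ⟨k, rfl⟩ : ∃ l, k = l + 1 := ⟨k - 1, by omega⟩
  obtain ⟨h0, h1⟩ := braidPerm_shift (show k + 1 < n by omega)
  have hd : braidPerm n (desc (braidSigma n) (k + 1) j) = desc (adj n) (k + 1) j := by
    rw [map_desc]
    simp only [braidPerm_braidSigma]
  rw [idxVertex, strandPair_mk, Sym2.map_mk, map_mul, Equiv.Perm.mul_apply, Equiv.Perm.mul_apply,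
    h0, h1, hd, desc_adj_apply hkj hj, desc_adj_apply_of_lt (by simp)]
  rfl

theorem eq_of_smul_idxVertex {n : ℕ} (hn : 2 ≤ n) (p p' : Idx n) (q : P n)
    (h : q • idxVertex p = idxVertex p') : p = p' := by
  have h1 := congrArg (strandPair hn) h
  rw [strandPair_smul, strandPair_idxVertex, strandPair_idxVertex, Sym2.eq_iff] at h1
  have h2 := p.2
  have h3 := p'.2
  simp only [Fin.mk.injEq] at h1
  apply Subtype.ext
  apply Prod.ext <;> omega

theorem exists_smul_idxVertex {n : ℕ} (hn : 2 ≤ n) (w : Vertex n) :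
    ∃ p : Idx n, ∃ q : P n, q • idxVertex p = w := by
  have key : ∀ x y : Fin n, x < y → strandPair hn w = s(x, y) →
      ∃ p : Idx n, ∃ q : P n, q • idxVertex p = w := by
    intro x y hxy h
    have hxy' : x.1 < y.1 := hxy
    refine ⟨⟨(x.1 + 1, y.1), by omega, hxy', y.2⟩, exists_smul_eq_of_strandPair_eq hn ?_⟩
    rw [strandPair_idxVertex, h]
    rfl
  obtain ⟨g, rfl⟩ := QuotientGroup.mk_surjective w
  have h := strandPair_mk hn g
  rw [Sym2.map_mk] at h
  have hne : braidPerm n g ⟨0, by omega⟩ ≠ braidPerm n g ⟨1, hn⟩ :=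
    (braidPerm n g).injective.ne (by simp)
  rcases lt_or_gt_of_ne hne with hlt | hlt
  · exact key _ _ hlt h
  · exact key _ _ hlt (h.trans Sym2.eq_swap)

theorem X_injective {n : ℕ} : Function.Injective (X (n := n)) := by
  intro p p' h
  have hn : 2 ≤ n := by have := p.2; omega
  rw [X_eq_singularConj, X_eq_singularConj] at h
  have h1 := congrArg (toModel n) h
  rw [toModel_singularConj hn, toModel_singularConj hn] at h1
  exact eq_of_smul_idxVertex hn p p' 1
    ((one_smul _ _).trans (GraphGroup.gen_injective (SemidirectProduct.inl_injective h1)))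

/-! ### The HNN decompositions -/

theorem map_P_eq (n : ℕ) : (P n).map (braidToSG n) = nonsingularSubgroup n := by
  rw [← closure_pureGen_braidSigma, MonoidHom.map_closure, nonsingularSubgroup]
  have h : ∀ k j, braidToSG n (pureGen (braidSigma n) k j) =
      ascending n k j * sigma n j ^ 2 * (ascending n k j)⁻¹ := by
    intro k j
    rw [map_pureGen]
    simp only [braidToSG_braidSigma]
    rfl
  congr 1
  ext s
  constructor
  · rintro ⟨_, ⟨k, j, hk, hkj, hj, rfl⟩, rfl⟩
    exact ⟨⟨(k, j), hk, hkj, hj⟩, (h k j).symm⟩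
  · rintro ⟨⟨⟨k, j⟩, hk, hkj, hj⟩, rfl⟩
    exact ⟨_, ⟨k, j, hk, hkj, hj, rfl⟩, h k j⟩

/-- The pure singular braids that involve only the singular generators in `J`. -/
theorem partialSubgroup_eq {n : ℕ} (J : Set (Idx n)) :
    partialSubgroup (pureToSG n) X J = Subgroup.closure (X '' J ∪ Set.range (a (n := n))) := by
  have h : nonsingularSubgroup n ≤ Subgroup.closure (X '' J ∪ Set.range (a (n := n))) :=
    Subgroup.closure_mono Set.subset_union_right
  refine le_antisymm (partialSubgroup_le (fun q => h ?_) fun p hp => ?_) ?_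
  · rw [← map_P_eq]
    exact ⟨q, q.2, rfl⟩
  · exact Subgroup.subset_closure (Or.inl ⟨p, hp, rfl⟩)
  · rw [Subgroup.closure_le]
    rintro _ (⟨p, hp, rfl⟩ | ⟨p, rfl⟩)
    · exact mem_partialSubgroup hp
    · have h1 : a p ∈ (P n).map (braidToSG n) := by
        rw [map_P_eq]
        exact Subgroup.subset_closure ⟨p, rfl⟩
      obtain ⟨q, hq, h2⟩ := h1
      rw [← h2]
      exact map_mem_partialSubgroup (j := pureToSG n) ⟨q, hq⟩

theorem partialSubgroup_empty (n : ℕ) :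
    partialSubgroup (pureToSG n) X ∅ = nonsingularSubgroup n := by
  rw [partialSubgroup_eq, Set.image_empty, Set.empty_union, nonsingularSubgroup]

theorem partialSubgroup_compl {n : ℕ} (p : Idx n) :
    partialSubgroup (pureToSG n) X {p}ᶜ = H p := by
  rw [partialSubgroup_eq, H, Set.image_compl_eq_range_sdiff_image X_injective, Set.image_singleton]

theorem partialSubgroup_univ {n : ℕ} (hn : 2 ≤ n) :
    partialSubgroup (pureToSG n) X Set.univ = SGP n := by
  have hK := isGraphExtension_SGP hn
  refine le_antisymm (partialSubgroup_le hK.map_mem fun p _ => ?_) fun s hs => ?_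
  · rw [X_eq_singularConj]
    exact hK.mem _
  · obtain ⟨m, hm, b, rfl⟩ := exists_eq_mul_braidToSG s
    have h1 : m ∈ SGP n := by
      refine (Subgroup.closure_le _).2 ?_ hm
      rintro _ ⟨v, rfl⟩
      exact hK.mem v
    have h2 : b ∈ P n := by
      have h3 := ((SGP n).mul_mem_cancel_left h1).1 hs
      rw [SGP, MonoidHom.mem_ker, singPerm_braidToSG] at h3
      exact h3
    refine Subgroup.mul_mem _ ((Subgroup.closure_le _).2 ?_ hm)
      (map_mem_partialSubgroup (j := pureToSG n) ⟨b, h2⟩)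
    rintro _ ⟨v, rfl⟩
    obtain ⟨p, q, rfl⟩ := exists_smul_idxVertex hn v
    rw [hK.conj, ← X_eq_singularConj]
    exact Subgroup.mul_mem _ (Subgroup.mul_mem _ (map_mem_partialSubgroup q)
      (mem_partialSubgroup (Set.mem_univ p))) (Subgroup.inv_mem _ (map_mem_partialSubgroup q))

theorem isHNN_partialSubgroup {n : ℕ} (J : Set (Idx n)) (p : Idx n) (hp : p ∉ J) :
    IsHNN (partialSubgroup (pureToSG n) X J) (partialSubgroup (pureToSG n) X (insert p J))
      (X p) := by
  have hn : 2 ≤ n := by have := p.2; omega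
  have hX : X = fun p : Idx n => singularConj n (idxVertex p) := funext X_eq_singularConj
  rw [hX]
  refine (isGraphExtension_SGP hn).isHNN idxVertex (exists_smul_idxVertex hn)
    (eq_of_smul_idxVertex hn) (fun p q q' => not_edge_of_strandPair_eq hn ?_)
    (fun _ _ => Edge.symm) J p hp
  rw [strandPair_smul, strandPair_smul]

theorem isIteratedHNN_partialSubgroup {n : ℕ} (l : List (Idx n)) (hl : l.Nodup)
    (J : Set (Idx n)) (hJ : ∀ p ∈ l, p ∉ J) :
    IsIteratedHNN (partialSubgroup (pureToSG n) X J)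
      (partialSubgroup (pureToSG n) X (J ∪ {p | p ∈ l})) (l.map X) := by
  induction l generalizing J with
  | nil => simpa using IsIteratedHNN.nil (partialSubgroup (pureToSG n) X J)
  | cons p l ih =>
    rw [List.nodup_cons] at hl
    have h1 := ih hl.2 (insert p J) (by
      intro p' hp'
      rw [Set.mem_insert_iff, not_or]
      exact ⟨fun h => hl.1 (h ▸ hp'), hJ p' (List.mem_cons_of_mem _ hp')⟩)
    have h2 : insert p J ∪ {p | p ∈ l} = J ∪ {p' | p' ∈ p :: l} := by
      ext p'
      simp only [Set.mem_union, Set.mem_insert_iff, Set.mem_ofPred_eq, List.mem_cons]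
      tauto
    rw [h2] at h1
    exact IsIteratedHNN.cons _ _ _ _ _
      (isHNN_partialSubgroup J p (hJ p List.mem_cons_self)) h1

theorem subsingleton_SG {n : ℕ} (hn : n < 2) : Subsingleton (SG n) := by
  have : IsEmpty (SingGen n) := ⟨fun x => by cases x <;> omega⟩
  exact (PresentedGroup.mk_surjective (sgRels n)).subsingleton

end SingBraid

theorem mainTheorem5 (n : ℕ) :
    -- each singular generator is the stable letter of an HNN decomposition
    (∀ p : SingBraid.Idx n, SingBraid.IsHNN (SingBraid.H p) (SingBraid.SGP n) (SingBraid.X p)) ∧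
    -- the subgroup generated by the nonsingular generators is the pure braid group
    (∃ f : SingBraid.P n ≃* SingBraid.nonsingularSubgroup n,
      ∀ b : SingBraid.P n, (f b : SingBraid.SG n) = SingBraid.braidToSG n b) ∧
    -- the pure singular braid group is an iterated HNN extension of it, the singular generators
    -- being the stable letters, in any order
    (∀ l : List (SingBraid.Idx n), l.Nodup → (∀ p, p ∈ l) →
      SingBraid.IsIteratedHNN (SingBraid.nonsingularSubgroup n) (SingBraid.SGP n)
        (l.map SingBraid.X)) := by
  refine ⟨fun p => ?_, ?_, fun l hl hmem => ?_⟩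
  · have hn : 2 ≤ n := by have := p.2; omega
    have h := SingBraid.isHNN_partialSubgroup {p}ᶜ p (by simp)
    have hu : insert p ({p}ᶜ : Set (SingBraid.Idx n)) = Set.univ := by
      ext p'
      simp [em]
    rwa [hu, SingBraid.partialSubgroup_compl, SingBraid.partialSubgroup_univ hn] at h
  · exact ⟨((SingBraid.P n).equivMapOfInjective _ (SingBraid.braidToSG_injective n)).trans
      (MulEquiv.subgroupCongr (SingBraid.map_P_eq n)), fun b => rfl⟩
  · rcases Nat.lt_or_ge n 2 with hn | hn
    · have := SingBraid.subsingleton_SG hn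
      have h1 : l = [] := List.eq_nil_iff_forall_not_mem.2 fun p _ => by
        have := p.2; omega
      have h2 : SingBraid.nonsingularSubgroup n = SingBraid.SGP n := Subsingleton.elim _ _
      rw [h1, h2]
      exact SingBraid.IsIteratedHNN.nil _
    · have h := SingBraid.isIteratedHNN_partialSubgroup l hl ∅ (by simp)
      have hu : (∅ ∪ {p | p ∈ l} : Set (SingBraid.Idx n)) = Set.univ := by
        ext p
        simp [hmem p]
      rwa [hu, SingBraid.partialSubgroup_empty, SingBraid.partialSubgroup_univ hn] at h
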